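/- Let $D\subset\mathbb R^d$ be a compact set of positive Lebesgue measure and let $\mathcal B(D)$ be the space of bounded measurable real functions on $D$. Let $R:D\to[0,\infty)$ be measurable with $\inf_{x\in D}R(x)>0$, and let $\beta_n\in\mathcal B(D)$, $n\ge0$, be strictly positive functions, bounded uniformly in $n$, which converge uniformly on $D$ to a function $\beta\in\mathcal B(D)$ with $\inf_{x\in D}\beta(x)>0$. For $x\in D$ and points $\mathbf y=(y_1,\dots,y_k)$ of $D$ let $n(x,\mathbf y)$ be the number of indices $i$ with $|x-y_i|\le R(x)$ (so $n(x,\emptyset)=0$). Let $X_1,X_2,\dots$ be random points of $D$ such that, for every $k\ge0$, the conditional distribution of $X_{k+1}$ given $X(k)=(X_1,\dots,X_k)$ has the density $$x\mapsto\frac{\beta_{n(x,X(k))}(x)}{\int_D\beta_{n(u,X(k))}(u)\,du},\qquad x\in D,$$ and put $\mu_m=\sum_{i=1}^m\delta_{X_i}$. Assume in addition that $|\beta_n(x)-\beta(x)|\le\tau(x)\varphi(n)$ for all $n\ge0$ and $x\in D$, where $\tau\in\mathcal B(D)$ satisfies $\inf_{x\in D}\tau(x)>0$, and where $\varphi(s)>0$,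 $s\ge0$, satisfies $\varphi(s)\to0$ as $s\to\infty$ and, for every $\delta>0$, $$\frac1{\sqrt n}\sum_{k=0}^n\varphi(k\delta)\to0\qquad(n\to\infty).$$ For $f,g\in\mathcal B(D)$ let $$J(f)=\frac{\int_D f(x)\beta(x)\,dx}{\int_D\beta(x)\,dx},\qquad G(f,g)=J(fg)-J(f)J(g).$$ Then, as $m\to\infty$, the centred and rescaled random measures $(\mu_m-\mathsf E\mu_m)/\sqrt m$ converge to a generalized Gaussian random field on $D$ with zero mean and covariance kernel $G$. That is, there is a centred Gaussian family $(Z(f))_{f\in\mathcal B(D)}$ with $\mathrm{Cov}(Z(f),Z(g))=G(f,g)$, which is linear in $f$ in the sense that $Z(af+bg)=aZ(f)+bZ(g)$ almost surely for all $a,b\in\mathbb R$ and $f,g\in\mathcal B(D)$, such that for all $f_1,\dots,f_n\in\mathcal B(D)$ the random vectors $$\left(\frac{1}{\sqrt m}\Big(\int_D f_i\,d\mu_m-\mathsf E\int_D f_i\,d\mu_m\Big)\right)_{i=1}^n$$ converge in distribution to $(Z(f_1),\dots,Z(f_n))$. In particular, for every $f\in\mathcal B(D)$ one has $G(f,f)\ge0$,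 and $$\frac1{\sqrt m}\sum_{k=1}^m\big(f(X_k)-\mathsf Ef(X_k)\big)$$ converges in distribution to $N(0,G(f,f))$. -/

import Mathlib

open MeasureTheory ProbabilityTheory Filter Topology

noncomputable section

namespace CSA

/-- The space `ℬ(D)` of real-valued bounded measurable functions on `D`. -/
def BddMeas {d : ℕ} (D : Set (EuclideanSpace ℝ (Fin d))) : Submodule ℝ (D → ℝ) where
  carrier := {f | Measurable f ∧ ∃ C : ℝ, ∀ x, |f x| ≤ C}
  zero_mem' := ⟨measurable_const, 0, fun _ => by simp⟩
  add_mem' := by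
    rintro f g ⟨hf, C, hC⟩ ⟨hg, C', hC'⟩
    exact ⟨hf.add hg, C + C', fun x => (abs_add_le _ _).trans (add_le_add (hC x) (hC' x))⟩
  smul_mem' := by
    rintro c f ⟨hf, C, hC⟩
    refine ⟨hf.const_smul c, |c| * C, fun x => ?_⟩
    simpa [abs_mul] using mul_le_mul_of_nonneg_left (hC x) (abs_nonneg c)

variable {d : ℕ} {D : Set (EuclideanSpace ℝ (Fin d))}

/-- Lebesgue measure of `ℝ^d`, restricted to `D` and regarded as a measure on the points of `D`. -/
def lebesgue (D : Set (EuclideanSpace ℝ (Fin d))) : Measure D :=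
  (volume : Measure (EuclideanSpace ℝ (Fin d))).comap Subtype.val

/-- `n(x, y)`: the number of points of the configuration `y = (y₁, …, y_k)` whose (Euclidean)
distance from `x` is at most the interaction radius `R x`. It is `0` for the empty configuration. -/
def neighborCount (R : D → ℝ) {k : ℕ} (x : D) (y : Fin k → D) : ℕ :=
  (Finset.univ.filter (fun i => dist x (y i) ≤ R x)).card

/-- The normalizing constant `α(y) = ∫_D β_{n(u, y)}(u) du`. -/
def normConst (R : D → ℝ) (β : ℕ → D → ℝ) {k : ℕ} (y : Fin k → D) : ℝ :=
  ∫ u, β (neighborCount R u y) u ∂(lebesgue D)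

/-- The probability density `ψ(x | y) = β_{n(x, y)}(x) / α(y)` of the next point, given that the
previous points are `y = (y₁, …, y_k)`. -/
def nextDensity (R : D → ℝ) (β : ℕ → D → ℝ) {k : ℕ} (y : Fin k → D) (x : D) : ℝ :=
  β (neighborCount R x y) x / normConst R β y

/-- The configuration formed by the first `k` points of the sequence `X`. The sequence is indexed
from `0`, so these are `X 0, …, X (k - 1)`. -/
def firstPoints {Ω : Type*} (X : ℕ → Ω → D) (k : ℕ) (ω : Ω) : Fin k → D :=
  fun i => X i ω

/-- The points `X 0, X 1, …` are generated by cooperative sequential adsorption on `D` with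
interaction radius `R` and intensities `β`: for every `k`, the conditional distribution of the
point `X k`, given the σ-algebra generated by the `k` points `X 0, …, X (k - 1)`, has the density
`ψ(· | X 0, …, X (k - 1))` with respect to Lebesgue measure on `D`. -/
structure IsAdsorptionSequence {Ω : Type*} [MeasurableSpace Ω] (P : Measure Ω)
    (R : D → ℝ) (β : ℕ → D → ℝ) (X : ℕ → Ω → D) : Prop where
  measurable : ∀ k, Measurable (X k)
  condLaw : ∀ (k : ℕ) (A : Set D), MeasurableSet A →
    P⟦X k ⁻¹' A | MeasurableSpace.comap (firstPoints X k) inferInstance⟧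
      =ᵐ[P] fun ω => ∫ x in A, nextDensity R β (firstPoints X k ω) x ∂(lebesgue D)

/-- The random point measure `μ_m`, the sum of the Dirac masses at the first `m` points. -/
def pointMeasure {Ω : Type*} (X : ℕ → Ω → D) (m : ℕ) (ω : Ω) : Measure D :=
  ∑ i ∈ Finset.range m, Measure.dirac (X i ω)

/-- The centred and rescaled random measure `(μ_m - E μ_m) / √m`, evaluated at the function `f`. -/
def fluctuation {Ω : Type*} [MeasurableSpace Ω] (P : Measure Ω) (X : ℕ → Ω → D) (m : ℕ)
    (f : D → ℝ) (ω : Ω) : ℝ :=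
  ((∫ x, f x ∂(pointMeasure X m ω)) - ∫ ω', (∫ x, f x ∂(pointMeasure X m ω')) ∂P) / √(m : ℝ)

/-- `J(f)`: the integral of `f` against the probability density `β / ∫_D β` on `D`. -/
def limitMean (β : D → ℝ) (f : D → ℝ) : ℝ :=
  (∫ x, f x * β x ∂(lebesgue D)) / ∫ x, β x ∂(lebesgue D)

/-- The covariance kernel `G(f, g) = J(f g) - J(f) J(g)`. -/
def covKernel (β : D → ℝ) (f g : D → ℝ) : ℝ :=
  limitMean β (fun x => f x * g x) - limitMean β f * limitMean β g

/-- `Z` is a generalized Gaussian random field on `D` with zero mean and covariance kernel `G`: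
a random linear functional on `ℬ(D)` all of whose finite-dimensional distributions are Gaussian. -/
structure IsCenteredGaussianField {Ω : Type*} [MeasurableSpace Ω] (P : Measure Ω)
    (G : (D → ℝ) → (D → ℝ) → ℝ) (Z : BddMeas D → Ω → ℝ) : Prop where
  gaussian : IsGaussianProcess Z P
  linear : ∀ (a b : ℝ) (f g : BddMeas D),
    Z (a • f + b • g) =ᵐ[P] fun ω => a * Z f ω + b * Z g ω
  mean_zero : ∀ f, ∫ ω, Z f ω ∂P = 0
  cov : ∀ f g : BddMeas D, covariance (Z f) (Z g) P = G f g

end CSA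

end

/-!
The fluctuations of the adsorption process are compared, through characteristic functions, with
those of independent points whose law `limitLaw βlim` has the density `βlim / ∫ βlim`.

Let `ε k` (`discrepancy`) be the expected `L¹` distance between the conditional density of `X k` and
that density. Replacing the points one at a time by independent ones shows
`|E ∏_{k<m} g (X k) - (∫ g d(limitLaw))^m| ≤ sup |g - 1| * ∑_{k<m} ε k` whenever `|g| ≤ 1`
(`norm_integral_prod_sub_pow_le`). For `g = exp (i (f - J f) / √m)` the supremum is `O(1/√m)`, so if
`∑_{k<m} ε k = o(√m)` then the central limit theorem for independent points carries over; the
same bound makes the difference between `E f (X k)` and `J f` negligible.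

The estimate of `∑ ε k` (`exists_sum_discrepancy_le`) rests on an occupation time argument. At a
point `x` the error of the `k`-th density is governed by `φ` at the number `N k` of earlier points
near `x`. For almost every `x` this number increases at each step with probability at least some
`q > 0`, independent of `x` and of the past (`exists_pos_le_setIntegral_ball`), so that it spends an
expected time of at most `1 / q` at each level, and `∑_{k<m} E φ (N k) ≤ q⁻¹ ∑_{j<m} φ j`
(`sum_integral_count_le`). The right-hand side is `o(√m)` by the summability hypothesis with
`δ = 1`; monotonicity of `φ` plays no role.

The limiting field is the isonormal process of `L²(limitLaw βlim)` evaluated at the centred test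
functions (`exists_isonormal`, `exists_gaussianField`). Since fluctuation and field are both linear
in the test function, convergence for single test functions gives joint convergence by Lévy's
continuity theorem.
-/

namespace CSA

variable {d : ℕ} {D : Set (EuclideanSpace ℝ (Fin d))}

/-! ### Intensities and conditional densities -/

lemma lebesgue_univ (hD : IsCompact D) : lebesgue D Set.univ = volume D := by
  rw [lebesgue, (MeasurableEmbedding.subtype_coe hD.measurableSet).comap_apply]
  simp

lemma isFiniteMeasure_lebesgue (hD : IsCompact D) : IsFiniteMeasure (lebesgue D) :=
  ⟨by rw [lebesgue_univ hD]; exact hD.measure_lt_top⟩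

lemma lebesgue_ne_zero (hD : IsCompact D) (hDpos : 0 < volume D) : lebesgue D ≠ 0 := by
  intro h
  have := lebesgue_univ hD
  rw [h] at this
  simp [← this] at hDpos

/-- The intensities `β n` lie between a strictly positive measurable function `βs`, the same for
all `n`, and a constant `C`. The lower bound need not be bounded away from `0`. -/
structure IntensityBounds (β : ℕ → D → ℝ) (βs : D → ℝ) (C : ℝ) : Prop where
  measurable : ∀ n, Measurable (β n)
  measurable_lower : Measurable βs
  lower_pos : ∀ x, 0 < βs x
  lower_le : ∀ n x, βs x ≤ β n x
  le_upper : ∀ n x, β n x ≤ C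

/-- Uniform convergence to a limit bounded away from `0` makes the pointwise infimum of strictly
positive intensities strictly positive. -/
lemma exists_intensityBounds {β : ℕ → D → ℝ} (hβmeas : ∀ n, Measurable (β n))
    (hβpos : ∀ n x, 0 < β n x) {C : ℝ} (hβbdd : ∀ n x, β n x ≤ C) {βlim : D → ℝ} {b : ℝ}
    (hb : 0 < b) (hβlim : ∀ x, b ≤ βlim x) (hβconv : TendstoUniformly β βlim atTop) :
    IntensityBounds β (fun x => ⨅ n, β n x) C where
  measurable := hβmeas
  measurable_lower := Measurable.iInf hβmeas
  lower_pos x := by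
    obtain ⟨n₀, hn₀⟩ := eventually_atTop.1 (Metric.tendstoUniformly_iff.1 hβconv (b / 2) (by linarith))
    obtain ⟨k, -, hk⟩ := Finset.exists_min_image (Finset.range (n₀ + 1)) (fun n => β n x) ⟨0, by simp⟩
    refine lt_of_lt_of_le (lt_min (hβpos k x) (half_pos hb)) (le_ciInf fun n => ?_)
    rcases le_total n₀ n with h | h
    · have h1 := hn₀ n h x
      rw [Real.dist_eq] at h1
      have h2 := (abs_lt.1 h1).2
      exact (min_le_right _ _).trans (by linarith [hβlim x])
    · exact (min_le_left _ _).trans (hk n (by simp; omega))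
  lower_le n x := ciInf_le ⟨0, by rintro _ ⟨n, rfl⟩; exact (hβpos n x).le⟩ n
  le_upper := hβbdd

lemma measurable_neighborCount {R : D → ℝ} (hR : Measurable R) (k : ℕ) :
    Measurable (fun p : (Fin k → D) × D => neighborCount R p.2 p.1) := by
  simp only [neighborCount, Finset.card_filter]
  refine Finset.measurable_sum _ fun i _ => Measurable.ite ?_ measurable_const measurable_const
  exact measurableSet_le (by fun_prop) (by fun_prop)

lemma neighborCount_le {R : D → ℝ} {k : ℕ} (x : D) (y : Fin k → D) : neighborCount R x y ≤ k := by
  simpa [neighborCount] using Finset.card_filter_le (Finset.univ : Finset (Fin k)) _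

namespace IntensityBounds

variable {β : ℕ → D → ℝ} {βs : D → ℝ} {C : ℝ} {R : D → ℝ}

lemma pos (h : IntensityBounds β βs C) (n : ℕ) (x : D) : 0 < β n x :=
  (h.lower_pos x).trans_le (h.lower_le n x)

lemma measurable_neighbor (h : IntensityBounds β βs C) (hR : Measurable R) (k : ℕ) :
    Measurable (fun p : (Fin k → D) × D => β (neighborCount R p.2 p.1) p.2) := by
  have : Measurable (fun q : ℕ × D => β q.1 q.2) := measurable_from_prod_countable_right h.measurable
  exact this.comp ((measurable_neighborCount hR k).prodMk measurable_snd)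

variable [IsFiniteMeasure (lebesgue D)]

lemma integrable_neighbor (h : IntensityBounds β βs C) (hR : Measurable R) {k : ℕ}
    (y : Fin k → D) : Integrable (fun u => β (neighborCount R u y) u) (lebesgue D) := by
  refine Integrable.of_bound (C := C)
    ((h.measurable_neighbor hR k).comp measurable_prodMk_left).aestronglyMeasurable (ae_of_all _ fun u => ?_)
  rw [Real.norm_of_nonneg (h.pos _ _).le]
  exact h.le_upper _ _

lemma integrable_lower (h : IntensityBounds β βs C) : Integrable βs (lebesgue D) := by
  refine Integrable.of_bound (C := C) h.measurable_lower.aestronglyMeasurable (ae_of_all _ fun u => ?_)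
  rw [Real.norm_of_nonneg (h.lower_pos _).le]
  exact (h.lower_le 0 u).trans (h.le_upper _ _)

lemma setIntegral_lower_pos (h : IntensityBounds β βs C) {A : Set D} (hA : lebesgue D A ≠ 0) :
    0 < ∫ u in A, βs u ∂(lebesgue D) := by
  rw [integral_pos_iff_support_of_nonneg (fun x => (h.lower_pos x).le) h.integrable_lower.integrableOn]
  have : Function.support βs = Set.univ := by
    ext x; simp [(h.lower_pos x).ne']
  simpa [this, pos_iff_ne_zero] using hA

lemma integral_lower_pos (h : IntensityBounds β βs C) (h0 : lebesgue D ≠ 0) :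
    0 < ∫ u, βs u ∂(lebesgue D) := by
  simpa using h.setIntegral_lower_pos (A := Set.univ) (by simpa using h0)

lemma le_normConst (h : IntensityBounds β βs C) (hR : Measurable R) {k : ℕ} (y : Fin k → D) :
    ∫ u, βs u ∂(lebesgue D) ≤ normConst R β y :=
  integral_mono h.integrable_lower (h.integrable_neighbor hR y) fun _ => h.lower_le _ _

lemma normConst_le (h : IntensityBounds β βs C) (hR : Measurable R) {k : ℕ} (y : Fin k → D) :
    normConst R β y ≤ C * (lebesgue D).real Set.univ := by
  refine (integral_mono (h.integrable_neighbor hR y) (integrable_const C)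
    fun _ => h.le_upper _ _).trans_eq ?_
  simp [mul_comm]

lemma normConst_pos (h : IntensityBounds β βs C) (h0 : lebesgue D ≠ 0) (hR : Measurable R) {k : ℕ}
    (y : Fin k → D) : 0 < normConst R β y :=
  (h.integral_lower_pos h0).trans_le (h.le_normConst hR y)

lemma measurable_normConst (h : IntensityBounds β βs C) (hR : Measurable R) (k : ℕ) :
    Measurable (fun y : Fin k → D => normConst R β y) :=
  (h.measurable_neighbor hR k).stronglyMeasurable.integral_prod_right'.measurable

lemma measurable_nextDensity (h : IntensityBounds β βs C) (hR : Measurable R) (k : ℕ) :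
    Measurable (fun p : (Fin k → D) × D => nextDensity R β p.1 p.2) :=
  (h.measurable_neighbor hR k).div ((h.measurable_normConst hR k).comp measurable_fst)

lemma nextDensity_nonneg (h : IntensityBounds β βs C) (h0 : lebesgue D ≠ 0) (hR : Measurable R)
    {k : ℕ} (y : Fin k → D) (x : D) : 0 ≤ nextDensity R β y x :=
  div_nonneg (h.pos _ _).le (h.normConst_pos h0 hR y).le

lemma nextDensity_le (h : IntensityBounds β βs C) (h0 : lebesgue D ≠ 0) (hR : Measurable R)
    {k : ℕ} (y : Fin k → D) (x : D) :
    nextDensity R β y x ≤ C / ∫ u, βs u ∂(lebesgue D) :=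
  div_le_div₀ ((h.pos 0 x).le.trans (h.le_upper 0 x)) (h.le_upper _ _) (h.integral_lower_pos h0)
    (h.le_normConst hR y)

lemma integrable_nextDensity (h : IntensityBounds β βs C) (hR : Measurable R)
    {k : ℕ} (y : Fin k → D) : Integrable (nextDensity R β y) (lebesgue D) :=
  (h.integrable_neighbor hR y).div_const _

lemma integral_nextDensity (h : IntensityBounds β βs C) (h0 : lebesgue D ≠ 0) (hR : Measurable R)
    {k : ℕ} (y : Fin k → D) : ∫ x, nextDensity R β y x ∂(lebesgue D) = 1 := by
  simp only [nextDensity, integral_div]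
  exact div_self (h.normConst_pos h0 hR y).ne'

lemma setIntegral_nextDensity_ge (h : IntensityBounds β βs C) (h0 : lebesgue D ≠ 0)
    (hR : Measurable R) {k : ℕ} (y : Fin k → D) (A : Set D) :
    (∫ u in A, βs u ∂(lebesgue D)) / (C * (lebesgue D).real Set.univ)
      ≤ ∫ u in A, nextDensity R β y u ∂(lebesgue D) := by
  simp only [nextDensity, integral_div]
  exact div_le_div₀ (integral_nonneg fun u => (h.pos _ _).le)
    (integral_mono h.integrable_lower.integrableOn (h.integrable_neighbor hR y).integrableOn
      fun _ => h.lower_le _ _) (h.normConst_pos h0 hR y) (h.normConst_le hR y)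

end IntensityBounds

/-- By compactness, the balls of a fixed radius that have positive volume carry a mass of `βs`
bounded away from `0`; the centres of the other balls form a null set. -/
lemma exists_pos_le_setIntegral_ball (hD : IsCompact D) [IsFiniteMeasure (lebesgue D)]
    {β : ℕ → D → ℝ} {βs : D → ℝ} {C : ℝ} (h : IntensityBounds β βs C) {r : ℝ} (hr : 0 < r)
    {R : D → ℝ} (hR : ∀ x, r ≤ R x) :
    ∃ c : ℝ, 0 < c ∧
      ∀ᵐ x ∂(lebesgue D), c ≤ ∫ u in {u | dist x u ≤ R x}, βs u ∂(lebesgue D) := by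
  have : CompactSpace D := isCompact_iff_compactSpace.1 hD
  obtain ⟨t, -, htf, htc⟩ := finite_cover_balls_of_compact (isCompact_univ (X := D)) (half_pos hr)
  have hc : ∀ᶠ c : ℝ in 𝓝[>] 0, ∀ y ∈ t, lebesgue D (Metric.ball y (r / 2)) ≠ 0 →
      c ≤ ∫ u in Metric.ball y (r / 2), βs u ∂(lebesgue D) := by
    refine (eventually_all_finite htf).2 fun y _ => ?_
    by_cases hy : lebesgue D (Metric.ball y (r / 2)) = 0
    · simp [hy]
    · filter_upwards [nhdsWithin_le_nhds (Iic_mem_nhds (h.setIntegral_lower_pos hy))] with c hc _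
      exact hc
  obtain ⟨c, hc, hc0⟩ := (hc.and self_mem_nhdsWithin).exists
  refine ⟨c, hc0, ?_⟩
  have hnull : ∀ᵐ x ∂(lebesgue D), ∀ y ∈ t, lebesgue D (Metric.ball y (r / 2)) = 0 →
      x ∉ Metric.ball y (r / 2) := by
    refine (ae_ball_iff htf.countable).2 fun y _ => ?_
    by_cases hy : lebesgue D (Metric.ball y (r / 2)) = 0
    · simpa [hy] using measure_eq_zero_iff_ae_notMem.1 hy
    · simp [hy]
  filter_upwards [hnull] with x hx
  obtain ⟨y, hy, hxy⟩ := Set.mem_iUnion₂.1 (htc (Set.mem_univ x))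
  refine (hc y hy fun h0 => hx y hy h0 hxy).trans (setIntegral_mono_set
    h.integrable_lower.integrableOn (ae_of_all _ fun u => (h.lower_pos u).le)
    (LE.le.eventuallyLE fun u hu => ?_))
  have h1 := dist_triangle_right x u y
  have h2 := hR x
  rw [Metric.mem_ball] at hxy hu
  simp only [Set.mem_ofPred_eq]
  linarith

/-! ### The law of the next point -/

section NextPoint

variable {Ω : Type*} [MeasurableSpace Ω] {P : Measure Ω}
  {β : ℕ → D → ℝ} {βs : D → ℝ} {C : ℝ} {R : D → ℝ} {X : ℕ → Ω → D}

lemma IsAdsorptionSequence.measurable_firstPoints (hX : IsAdsorptionSequence P R β X) (k : ℕ) :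
    Measurable (firstPoints X k) :=
  measurable_pi_lambda _ fun i => hX.measurable i

variable [IsProbabilityMeasure P] [IsFiniteMeasure (lebesgue D)]

/-- The joint law of the first `k` points and of the next one has the density `nextDensity`
with respect to the product of the law of the first `k` points and Lebesgue measure. -/
lemma IsAdsorptionSequence.map_prodMk (hX : IsAdsorptionSequence P R β X)
    (h : IntensityBounds β βs C) (h0 : lebesgue D ≠ 0) (hR : Measurable R) (k : ℕ) :
    P.map (fun ω => (firstPoints X k ω, X k ω)) =
      ((P.map (firstPoints X k)).prod (lebesgue D)).withDensity
        (fun p => ENNReal.ofReal (nextDensity R β p.1 p.2)) := by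
  have hm := hX.measurable_firstPoints k
  have hψ := (h.measurable_nextDensity hR k).ennreal_ofReal
  have : IsProbabilityMeasure (P.map (firstPoints X k)) := Measure.isProbabilityMeasure_map hm.aemeasurable
  have : IsProbabilityMeasure (P.map (fun ω => (firstPoints X k ω, X k ω))) :=
    Measure.isProbabilityMeasure_map (hm.prodMk (hX.measurable k)).aemeasurable
  refine Measure.ext_prod fun {S A} hS hA => ?_
  rw [Measure.map_apply (hm.prodMk (hX.measurable k)) (hS.prod hA), withDensity_apply _ (hS.prod hA),
    ← Measure.prod_restrict, lintegral_prod _ hψ.aemeasurable, setLIntegral_map hS _ hm]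
  swap
  · exact hψ.lintegral_prod_right'
  have hS' : MeasurableSet[MeasurableSpace.comap (firstPoints X k) inferInstance]
      (firstPoints X k ⁻¹' S) := ⟨S, hS, rfl⟩
  have hA' : MeasurableSet (X k ⁻¹' A) := hX.measurable k hA
  have h1 := setIntegral_condExp (μ := P) hm.comap_le
    ((integrable_const (1 : ℝ)).indicator hA') hS'
  rw [setIntegral_congr_ae (g := fun ω => ∫ x in A, nextDensity R β (firstPoints X k ω) x ∂(lebesgue D))
    (hm hS) ((hX.condLaw k A hA).mono fun ω hω _ => hω), setIntegral_indicator hA'] at h1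
  have h2 : ∀ y : Fin k → D, ∫⁻ x in A, ENNReal.ofReal (nextDensity R β y x) ∂(lebesgue D) =
      ENNReal.ofReal (∫ x in A, nextDensity R β y x ∂(lebesgue D)) := fun y =>
    (ofReal_integral_eq_lintegral_ofReal (h.integrable_nextDensity hR y).integrableOn
      (ae_of_all _ fun x => h.nextDensity_nonneg h0 hR y x)).symm
  simp_rw [h2]
  have hnn : ∀ y : Fin k → D, 0 ≤ ∫ x in A, nextDensity R β y x ∂(lebesgue D) := fun y =>
    integral_nonneg fun x => h.nextDensity_nonneg h0 hR y x
  have hmeas : Measurable fun y : Fin k → D => ∫ x in A, nextDensity R β y x ∂(lebesgue D) :=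
    (h.measurable_nextDensity hR k).stronglyMeasurable.integral_prod_right'.measurable
  have hle : ∀ y : Fin k → D, ∫ x in A, nextDensity R β y x ∂(lebesgue D) ≤ 1 := fun y =>
    (setIntegral_le_integral (h.integrable_nextDensity hR y)
      (ae_of_all _ fun x => h.nextDensity_nonneg h0 hR y x)).trans_eq (h.integral_nextDensity h0 hR y)
  rw [← ofReal_integral_eq_lintegral_ofReal _ (ae_of_all _ fun ω => hnn _), h1]
  · simp only [integral_const, smul_eq_mul, mul_one, measureReal_restrict_apply_univ]
    rw [ofReal_measureReal]
    rfl
  · refine (Integrable.of_bound (C := 1) (hmeas.comp hm).aestronglyMeasurable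
      (ae_of_all _ fun ω => ?_)).integrableOn
    rw [Function.comp_apply, Real.norm_of_nonneg (hnn _)]
    exact hle _

/-- Integrating a bounded function of the first `k` points and the next point. -/
lemma IsAdsorptionSequence.integral_next (hX : IsAdsorptionSequence P R β X)
    (h : IntensityBounds β βs C) (h0 : lebesgue D ≠ 0) (hR : Measurable R) (k : ℕ)
    {E : Type*} [NormedAddCommGroup E] [NormedSpace ℝ E] [CompleteSpace E]
    {F : (Fin k → D) × D → E} (hF : StronglyMeasurable F) {M : ℝ} (hM : ∀ p, ‖F p‖ ≤ M) :
    ∫ ω, F (firstPoints X k ω, X k ω) ∂P =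
      ∫ ω, ∫ x, nextDensity R β (firstPoints X k ω) x • F (firstPoints X k ω, x) ∂(lebesgue D) ∂P := by
  have hm := hX.measurable_firstPoints k
  have : IsProbabilityMeasure (P.map (firstPoints X k)) := Measure.isProbabilityMeasure_map hm.aemeasurable
  have hψ := h.measurable_nextDensity hR k
  have hψF : StronglyMeasurable fun p : (Fin k → D) × D => nextDensity R β p.1 p.2 • F p :=
    hψ.stronglyMeasurable.smul hF
  rw [← integral_map (f := F) (hm.prodMk (hX.measurable k)).aemeasurable hF.aestronglyMeasurable,
    hX.map_prodMk h h0 hR, integral_withDensity_eq_integral_toReal_smul hψ.ennreal_ofReal (by simp)]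
  simp_rw [ENNReal.toReal_ofReal (h.nextDensity_nonneg h0 hR _ _)]
  rw [integral_prod, integral_map (f := fun y => ∫ x, nextDensity R β y x • F (y, x) ∂(lebesgue D))
    hm.aemeasurable hψF.integral_prod_right'.aestronglyMeasurable]
  refine Integrable.of_bound (C := C / (∫ u, βs u ∂(lebesgue D)) * M) hψF.aestronglyMeasurable
    (ae_of_all _ fun p => ?_)
  rw [norm_smul, Real.norm_of_nonneg (h.nextDensity_nonneg h0 hR _ _)]
  have := h.nextDensity_le h0 hR p.1 p.2
  exact mul_le_mul this (hM p) (norm_nonneg _) ((h.nextDensity_nonneg h0 hR _ _).trans this)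

end NextPoint

/-! ### Occupation times of the neighbour counts -/

section Occupation

lemma neighborCount_firstPoints_succ {Ω : Type*} {R : D → ℝ} {X : ℕ → Ω → D}
    (x : D) (k : ℕ) (ω : Ω) :
    neighborCount R x (firstPoints X (k + 1) ω) =
      neighborCount R x (firstPoints X k ω) + if dist x (X k ω) ≤ R x then 1 else 0 := by
  simp only [neighborCount, Finset.card_filter, Fin.sum_univ_castSucc]
  rfl

lemma abs_comp_neighborCount_le {R : D → ℝ} {φ : ℕ → ℝ} (hφ : ∀ n, 0 ≤ φ n) {k : ℕ} (x : D)
    (y : Fin k → D) : |φ (neighborCount R x y)| ≤ ∑ j ∈ Finset.range (k + 1), φ j := by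
  rw [abs_of_nonneg (hφ _)]
  exact Finset.single_le_sum (f := φ) (fun j _ => hφ j)
    (Finset.mem_range.2 (Nat.lt_succ_of_le (neighborCount_le x y)))

variable {Ω : Type*} [MeasurableSpace Ω] {P : Measure Ω}
  {β : ℕ → D → ℝ} {βs : D → ℝ} {C : ℝ} {R : D → ℝ} {X : ℕ → Ω → D}

lemma IsAdsorptionSequence.measurable_count (hX : IsAdsorptionSequence P R β X)
    (hR : Measurable R) (k : ℕ) :
    Measurable (fun p : Ω × D => neighborCount R p.2 (firstPoints X k p.1)) := by
  have hp : Measurable (fun p : Ω × D => (firstPoints X k p.1, p.2)) :=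
    ((hX.measurable_firstPoints k).comp measurable_fst).prodMk measurable_snd
  have := (measurable_neighborCount hR k).comp hp
  simpa only [Function.comp_def] using this

variable [IsProbabilityMeasure P] [IsFiniteMeasure (lebesgue D)]

/-- The number of points near `x` increases with probability at least `q` at each step, whatever
the past, so it spends an expected time of at most `1 / q` at every level. The proof
compares with the potential `∑ j < n, φ j` evaluated at the number `n` of neighbours. -/
lemma IsAdsorptionSequence.sum_integral_count_le (hX : IsAdsorptionSequence P R β X)
    (h : IntensityBounds β βs C) (h0 : lebesgue D ≠ 0) (hR : Measurable R)
    {φ : ℕ → ℝ} (hφ : ∀ n, 0 ≤ φ n) {x : D} {q : ℝ} (hq : 0 < q)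
    (hx : ∀ (k : ℕ) (y : Fin k → D),
      q ≤ ∫ u in {u | dist x u ≤ R x}, nextDensity R β y u ∂(lebesgue D)) (m : ℕ) :
    ∑ k ∈ Finset.range m, ∫ ω, φ (neighborCount R x (firstPoints X k ω)) ∂P
      ≤ q⁻¹ * ∑ j ∈ Finset.range m, φ j := by
  set N : ℕ → Ω → ℕ := fun k ω => neighborCount R x (firstPoints X k ω) with hN
  have hNm : ∀ k, Measurable (N k) := fun k => by
    have hp : Measurable (fun ω : Ω => (ω, x)) := measurable_prodMk_right
    have := (hX.measurable_count hR k).comp hp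
    simpa only [Function.comp_def] using this
  have hNk : ∀ k ω, N k ω ≤ k := fun k ω => neighborCount_le _ _
  set Ψ : ℕ → ℝ := fun n => ∑ j ∈ Finset.range n, φ j with hΨ
  have hΨmono : Monotone Ψ := fun a b hab => Finset.sum_le_sum_of_subset_of_nonneg
    (Finset.range_mono hab) fun j _ _ => hφ j
  have hΨ0 : ∀ n, 0 ≤ Ψ n := fun n => Finset.sum_nonneg fun j _ => hφ j
  have hint : ∀ (g : ℕ → ℝ) (M : ℝ) (k : ℕ), (∀ ω, |g (N k ω)| ≤ M) →
      Integrable (fun ω => g (N k ω)) P := fun g M k hg =>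
    Integrable.of_bound (C := M) ((measurable_of_countable g).comp (hNm k)).aestronglyMeasurable
      (ae_of_all _ hg)
  have hΨint : ∀ k, Integrable (fun ω => Ψ (N k ω)) P := fun k => hint Ψ (Ψ k) k fun ω => by
    rw [abs_of_nonneg (hΨ0 _)]; exact hΨmono (hNk k ω)
  have hset : MeasurableSet {u : D | dist x u ≤ R x} := measurableSet_le (by fun_prop) (by fun_prop)
  -- the potential grows by `φ (N k)` exactly when the next point falls near `x`
  have hstep : ∀ k, q * ∫ ω, φ (N k ω) ∂P ≤ (∫ ω, Ψ (N (k + 1) ω) ∂P) - ∫ ω, Ψ (N k ω) ∂P := by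
    intro k
    have e1 : ∀ ω, Ψ (N (k + 1) ω) - Ψ (N k ω) =
        φ (N k ω) * {u : D | dist x u ≤ R x}.indicator 1 (X k ω) := by
      intro ω
      simp only [hN, neighborCount_firstPoints_succ, hΨ, Set.indicator_apply, Set.mem_ofPred_eq]
      split_ifs with hd
      · simp [Finset.sum_range_succ]
      · simp
    have hcount : Measurable fun p : (Fin k → D) × D => φ (neighborCount R x p.1) := by
      have hp : Measurable fun p : (Fin k → D) × D => (p.1, x) := by fun_prop
      have := (measurable_of_countable φ).comp ((measurable_neighborCount hR k).comp hp)
      simpa only [Function.comp_def] using this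
    have hind : Measurable fun p : (Fin k → D) × D =>
        {u : D | dist x u ≤ R x}.indicator (1 : D → ℝ) p.2 :=
      (measurable_one.indicator hset).comp measurable_snd
    rw [← integral_sub (hΨint _) (hΨint _)]
    simp_rw [e1]
    have e2 := hX.integral_next h h0 hR k (M := ∑ j ∈ Finset.range (k + 1), φ j)
      (F := fun p => φ (neighborCount R x p.1) * {u : D | dist x u ≤ R x}.indicator (1 : D → ℝ) p.2)
      (hcount.mul hind).stronglyMeasurable
      (fun p => by
        rw [norm_mul]
        refine (mul_le_of_le_one_right (norm_nonneg _) ?_).trans (abs_comp_neighborCount_le hφ _ _)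
        exact (norm_indicator_le_norm_self _ _).trans (by simp))
    simp only at e2
    rw [hN, e2, ← integral_const_mul]
    have e3 : ∀ ω, ∫ u, nextDensity R β (firstPoints X k ω) u •
        (φ (neighborCount R x (firstPoints X k ω)) *
          {u : D | dist x u ≤ R x}.indicator (1 : D → ℝ) u) ∂(lebesgue D) =
        (∫ u in {u | dist x u ≤ R x}, nextDensity R β (firstPoints X k ω) u ∂(lebesgue D)) *
          φ (N k ω) := by
      intro ω
      rw [← integral_indicator hset, ← integral_mul_const]
      refine integral_congr_ae (ae_of_all _ fun u => ?_)
      by_cases hu : u ∈ {u : D | dist x u ≤ R x} <;> simp [hu, hN]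
    simp_rw [e3]
    have hIm : Measurable fun ω => ∫ u in {u | dist x u ≤ R x},
        nextDensity R β (firstPoints X k ω) u ∂(lebesgue D) :=
      (h.measurable_nextDensity hR k).stronglyMeasurable.integral_prod_right'.measurable.comp
        (hX.measurable_firstPoints k)
    refine integral_mono ((hint φ _ k fun ω => abs_comp_neighborCount_le hφ _ _).const_mul q) ?_
      fun ω => mul_le_mul_of_nonneg_right (hx k _) (hφ _)
    refine Integrable.of_bound (C := 1 * ∑ j ∈ Finset.range (k + 1), φ j)
      (hIm.mul ((measurable_of_countable φ).comp (hNm k))).aestronglyMeasurable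
      (ae_of_all _ fun ω => ?_)
    rw [norm_mul]
    refine mul_le_mul ?_ (abs_comp_neighborCount_le hφ _ _) (norm_nonneg _) zero_le_one
    rw [Real.norm_of_nonneg (hq.le.trans (hx k _))]
    exact (setIntegral_le_integral (h.integrable_nextDensity hR _)
      (ae_of_all _ fun x => h.nextDensity_nonneg h0 hR _ x)).trans_eq (h.integral_nextDensity h0 hR _)
  have hsum := Finset.sum_le_sum fun k (_ : k ∈ Finset.range m) => hstep k
  rw [Finset.sum_range_sub (fun k => ∫ ω, Ψ (N k ω) ∂P), ← Finset.mul_sum] at hsum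
  have hm : ∫ ω, Ψ (N m ω) ∂P ≤ Ψ m := by
    refine (integral_mono (hΨint m) (integrable_const (Ψ m)) fun ω => hΨmono (hNk m ω)).trans_eq ?_
    simp
  have h00 : 0 ≤ ∫ ω, Ψ (N 0 ω) ∂P := integral_nonneg fun ω => hΨ0 _
  rw [← div_eq_inv_mul, le_div_iff₀' hq]
  linarith

end Occupation

/-! ### The limit law and the distance to it -/

/-- The probability measure on `D` with density `β / ∫_D β`; `limitMean β` is integration against
it. -/
noncomputable def limitLaw (β : D → ℝ) : Measure D :=
  (lebesgue D).withDensity fun x => ENNReal.ofReal (β x / ∫ u, β u ∂(lebesgue D))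

/-- The expected `L¹` distance between the conditional density of the point `X k` and the density of
the limit law. -/
noncomputable def discrepancy {Ω : Type*} [MeasurableSpace Ω] (P : Measure Ω) (R : D → ℝ)
    (β : ℕ → D → ℝ) (βlim : D → ℝ) (X : ℕ → Ω → D) (k : ℕ) : ℝ :=
  ∫ ω, ∫ x, |nextDensity R β (firstPoints X k ω) x - βlim x / ∫ u, βlim u ∂(lebesgue D)|
    ∂(lebesgue D) ∂P

section LimitLaw

variable {β : D → ℝ}

lemma integral_limitLaw (hβ : Measurable β) (hβ0 : ∀ x, 0 ≤ β x) {E : Type*}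
    [NormedAddCommGroup E] [NormedSpace ℝ E] (g : D → E) :
    ∫ x, g x ∂(limitLaw β) = ∫ x, (β x / ∫ u, β u ∂(lebesgue D)) • g x ∂(lebesgue D) := by
  rw [limitLaw, integral_withDensity_eq_integral_toReal_smul (hβ.div_const _).ennreal_ofReal (by simp)]
  refine integral_congr_ae (ae_of_all _ fun x => ?_)
  simp only [ENNReal.toReal_ofReal (div_nonneg (hβ0 x) (integral_nonneg hβ0))]

lemma limitMean_eq_integral (hβ : Measurable β) (hβ0 : ∀ x, 0 ≤ β x) (f : D → ℝ) :
    limitMean β f = ∫ x, f x ∂(limitLaw β) := by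
  rw [integral_limitLaw hβ hβ0, limitMean, ← integral_div]
  congr with x
  simp only [smul_eq_mul]
  ring

lemma isProbabilityMeasure_limitLaw (hβ0 : ∀ x, 0 ≤ β x)
    (hint : Integrable β (lebesgue D)) (hpos : 0 < ∫ u, β u ∂(lebesgue D)) :
    IsProbabilityMeasure (limitLaw β) := by
  refine ⟨?_⟩
  rw [limitLaw, withDensity_apply _ MeasurableSet.univ, Measure.restrict_univ,
    ← ofReal_integral_eq_lintegral_ofReal (hint.div_const _)
      (ae_of_all _ fun x => div_nonneg (hβ0 x) hpos.le), integral_div, div_self hpos.ne']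
  simp

end LimitLaw

section Discrepancy

variable {Ω : Type*} [MeasurableSpace Ω] {P : Measure Ω} [IsProbabilityMeasure P]
  {β : ℕ → D → ℝ} {βs : D → ℝ} {C : ℝ} {R : D → ℝ} {X : ℕ → Ω → D} {βlim : D → ℝ}
  [IsFiniteMeasure (lebesgue D)]

lemma integral_abs_nextDensity_sub_le (h : IntensityBounds β βs C) (h0 : lebesgue D ≠ 0)
    (hR : Measurable R) (hlim0 : ∀ x, 0 ≤ βlim x)
    (hlimint : Integrable βlim (lebesgue D)) (hlimpos : 0 < ∫ u, βlim u ∂(lebesgue D))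
    {k : ℕ} (y : Fin k → D) :
    ∫ x, |nextDensity R β y x - βlim x / ∫ u, βlim u ∂(lebesgue D)| ∂(lebesgue D) ≤
      2 / (∫ u, βs u ∂(lebesgue D)) *
        ∫ x, |β (neighborCount R x y) x - βlim x| ∂(lebesgue D) := by
  set α := normConst R β y with hα
  set B := ∫ u, βlim u ∂(lebesgue D) with hB
  set I := ∫ x, |β (neighborCount R x y) x - βlim x| ∂(lebesgue D) with hI
  have hαpos : 0 < α := h.normConst_pos h0 hR y
  have hint := h.integrable_neighbor hR y
  have hI0 : 0 ≤ I := integral_nonneg fun x => abs_nonneg _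
  -- the normalizing constants differ by no more than the intensities do in `L¹`
  have hBα : |B - α| ≤ I := by
    rw [abs_sub_comm, hα, normConst, hB, ← integral_sub hint hlimint]
    exact abs_integral_le_integral_abs
  have hpt : ∀ x, |nextDensity R β y x - βlim x / B| ≤
      |β (neighborCount R x y) x - βlim x| / α + βlim x * (I / (α * B)) := by
    intro x
    have e : nextDensity R β y x - βlim x / B =
        (β (neighborCount R x y) x - βlim x) / α + βlim x * ((B - α) / (α * B)) := by
      rw [nextDensity, ← hα]
      field_simp
      ring
    rw [e]
    refine (abs_add_le _ _).trans (add_le_add ?_ ?_)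
    · rw [abs_div, abs_of_pos hαpos]
    · rw [abs_mul, abs_of_nonneg (hlim0 x), abs_div, abs_of_pos (mul_pos hαpos hlimpos)]
      have := hlim0 x
      gcongr
  have hd : Integrable (fun x => |β (neighborCount R x y) x - βlim x|) (lebesgue D) :=
    (hint.sub hlimint).abs
  calc _ ≤ ∫ x, (|β (neighborCount R x y) x - βlim x| / α + βlim x * (I / (α * B)))
        ∂(lebesgue D) :=
        integral_mono ((h.integrable_nextDensity hR y).sub (hlimint.div_const B)).abs
          ((hd.div_const α).add (hlimint.mul_const _)) hpt
    _ = 2 / α * I := by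
        rw [integral_add (hd.div_const α) (hlimint.mul_const _), integral_div, integral_mul_const,
          ← hI, ← hB]
        field_simp
        ring
    _ ≤ _ := by
        have := h.integral_lower_pos h0
        have := h.le_normConst hR y
        gcongr

/-- The discrepancies add up to at most a multiple of `∑ j < m, φ j`: the error of the `k`-th
density at `x` is governed by `φ` at the current number of neighbours of `x`, and this number
spends a bounded expected time at each level. Monotonicity of `φ` is not needed. -/
lemma IsAdsorptionSequence.exists_sum_discrepancy_le (hX : IsAdsorptionSequence P R β X)
    (hD : IsCompact D) (h : IntensityBounds β βs C) (h0 : lebesgue D ≠ 0) (hR : Measurable R)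
    {r : ℝ} (hr : 0 < r) (hRr : ∀ x, r ≤ R x) (hlim0 : ∀ x, 0 ≤ βlim x)
    (hlimint : Integrable βlim (lebesgue D)) (hlimpos : 0 < ∫ u, βlim u ∂(lebesgue D))
    {φ : ℕ → ℝ} (hφ : ∀ n, 0 ≤ φ n) {T : ℝ} (hT : 0 ≤ T)
    (hrate : ∀ n x, |β n x - βlim x| ≤ T * φ n) :
    ∃ K : ℝ, ∀ m : ℕ, ∑ k ∈ Finset.range m, discrepancy P R β βlim X k ≤
      K * ∑ j ∈ Finset.range m, φ j := by
  obtain ⟨c, hc, hcx⟩ := exists_pos_le_setIntegral_ball hD h hr hRr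
  set V := (lebesgue D).real Set.univ with hV
  have hVpos : 0 < V := by
    rw [hV, measureReal_def]
    exact ENNReal.toReal_pos (by simpa using h0) (measure_ne_top _ _)
  have : Nonempty D := by
    by_contra hne
    have := not_nonempty_iff.1 hne
    exact h0 (Measure.eq_zero_of_isEmpty _)
  have hC : 0 < C := (h.pos 0 (Classical.arbitrary D)).trans_le (h.le_upper 0 _)
  have hq : 0 < c / (C * V) := by positivity
  set A := 2 / (∫ u, βs u ∂(lebesgue D)) * T with hA
  have hApos : 0 ≤ A := mul_nonneg (div_nonneg zero_le_two (h.integral_lower_pos h0).le) hT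
  have hNint : ∀ k, Integrable (fun p : Ω × D => φ (neighborCount R p.2 (firstPoints X k p.1)))
      (P.prod (lebesgue D)) := fun k => by
    have hm := (measurable_of_countable φ).comp (hX.measurable_count hR k)
    simp only [Function.comp_def] at hm
    exact Integrable.of_bound (C := ∑ j ∈ Finset.range (k + 1), φ j) hm.aestronglyMeasurable
      (ae_of_all _ fun p => abs_comp_neighborCount_le hφ _ _)
  have hk : ∀ k, discrepancy P R β βlim X k ≤
      A * ∫ x, ∫ ω, φ (neighborCount R x (firstPoints X k ω)) ∂P ∂(lebesgue D) := by
    intro k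
    rw [← integral_integral_swap (hNint k), ← integral_const_mul]
    refine integral_mono_of_nonneg (ae_of_all _ fun ω => integral_nonneg fun x => abs_nonneg _)
      ((hNint k).integral_prod_left.const_mul A) ?_
    filter_upwards [(hNint k).prod_right_ae] with ω hω
    refine (integral_abs_nextDensity_sub_le h h0 hR hlim0 hlimint hlimpos _).trans ?_
    rw [hA, mul_assoc, ← integral_const_mul T]
    refine mul_le_mul_of_nonneg_left ?_ (div_nonneg zero_le_two (h.integral_lower_pos h0).le)
    exact integral_mono ((h.integrable_neighbor hR _).sub hlimint).abs (hω.const_mul T)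
      fun x => hrate _ _
  refine ⟨A * (V * (c / (C * V))⁻¹), fun m => ?_⟩
  calc ∑ k ∈ Finset.range m, discrepancy P R β βlim X k
      ≤ ∑ k ∈ Finset.range m,
          A * ∫ x, ∫ ω, φ (neighborCount R x (firstPoints X k ω)) ∂P ∂(lebesgue D) :=
        Finset.sum_le_sum fun k _ => hk k
    _ = A * ∫ x, ∑ k ∈ Finset.range m, ∫ ω, φ (neighborCount R x (firstPoints X k ω)) ∂P
          ∂(lebesgue D) := by
        rw [← Finset.mul_sum, integral_finsetSum _ fun k _ => (hNint k).integral_prod_right]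
    _ ≤ A * ∫ x, (c / (C * V))⁻¹ * ∑ j ∈ Finset.range m, φ j ∂(lebesgue D) := by
        refine mul_le_mul_of_nonneg_left (integral_mono_of_nonneg (ae_of_all _ fun x =>
          Finset.sum_nonneg fun k _ => integral_nonneg fun ω => hφ _) (integrable_const _) ?_) hApos
        filter_upwards [hcx] with x hx
        refine hX.sum_integral_count_le h h0 hR hφ hq (fun k y => ?_) m
        exact (div_le_div_of_nonneg_right hx (by positivity)).trans
          (h.setIntegral_nextDensity_ge h0 hR y _)
    _ = _ := by
        rw [integral_const, smul_eq_mul, ← hV]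
        ring

/-! ### Comparison with independent points -/

/-- Replacing the next point by an independent point with the limit law costs at most the
oscillation of the test function times the discrepancy. -/
lemma IsAdsorptionSequence.norm_integral_mul_sub_le (hX : IsAdsorptionSequence P R β X)
    (h : IntensityBounds β βs C) (h0 : lebesgue D ≠ 0) (hR : Measurable R)
    (hlim : Measurable βlim) (hlim0 : ∀ x, 0 ≤ βlim x)
    (hlimint : Integrable βlim (lebesgue D)) (hlimpos : 0 < ∫ u, βlim u ∂(lebesgue D))
    {𝕜 : Type*} [RCLike 𝕜] (k : ℕ) {U : (Fin k → D) → 𝕜} (hU : Measurable U)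
    (hU1 : ∀ y, ‖U y‖ ≤ 1) {g : D → 𝕜} (hg : Measurable g) {a : 𝕜} {s : ℝ}
    (hgs : ∀ x, ‖g x - a‖ ≤ s) :
    ‖(∫ ω, U (firstPoints X k ω) * g (X k ω) ∂P) -
        (∫ ω, U (firstPoints X k ω) ∂P) * ∫ x, g x ∂(limitLaw βlim)‖ ≤
      s * discrepancy P R β βlim X k := by
  have : IsProbabilityMeasure (limitLaw βlim) := isProbabilityMeasure_limitLaw hlim0 hlimint hlimpos
  set B := ∫ u, βlim u ∂(lebesgue D) with hB
  have hm := hX.measurable_firstPoints k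
  have hUm : Measurable fun ω => U (firstPoints X k ω) := hU.comp hm
  have hUint : Integrable (fun ω => U (firstPoints X k ω)) P :=
    Integrable.of_bound (C := 1) hUm.aestronglyMeasurable (ae_of_all _ fun ω => hU1 _)
  have hga : Measurable fun x => g x - a := hg.sub_const a
  have hUs : ∀ (y : Fin k → D) x, ‖U y * (g x - a)‖ ≤ s := fun y x => by
    rw [norm_mul]
    exact (mul_le_of_le_one_left (norm_nonneg _) (hU1 y)).trans (hgs x)
  have hgint : ∀ μ : Measure D, IsFiniteMeasure μ → Integrable (fun x => g x - a) μ := fun μ _ =>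
    Integrable.of_bound (C := s) hga.aestronglyMeasurable (ae_of_all _ hgs)
  have hUgm : Measurable fun ω => U (firstPoints X k ω) * (g (X k ω) - a) :=
    hUm.mul (hga.comp (hX.measurable k))
  -- subtracting the constant `a` from `g` does not change the difference
  have e1 : (∫ ω, U (firstPoints X k ω) * g (X k ω) ∂P) -
        (∫ ω, U (firstPoints X k ω) ∂P) * ∫ x, g x ∂(limitLaw βlim) =
      (∫ ω, U (firstPoints X k ω) * (g (X k ω) - a) ∂P) -
        (∫ ω, U (firstPoints X k ω) ∂P) * ∫ x, (g x - a) ∂(limitLaw βlim) := by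
    have i1 : Integrable (fun ω => U (firstPoints X k ω) * (g (X k ω) - a)) P :=
      Integrable.of_bound (C := s) hUgm.aestronglyMeasurable (ae_of_all _ fun ω => hUs _ _)
    have i2 : Integrable g (limitLaw βlim) := by
      refine ((hgint (limitLaw βlim) inferInstance).add (integrable_const a)).congr
        (ae_of_all _ fun x => ?_)
      simp
    have e2 : ∀ ω, U (firstPoints X k ω) * g (X k ω) =
        U (firstPoints X k ω) * (g (X k ω) - a) + U (firstPoints X k ω) * a := fun ω => by ring
    simp_rw [e2]
    rw [integral_add i1 (hUint.mul_const a), integral_sub i2 (integrable_const a),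
      integral_mul_const]
    simp only [integral_const, probReal_univ, one_smul]
    ring
  have e3 : ∫ ω, U (firstPoints X k ω) * (g (X k ω) - a) ∂P =
      ∫ ω, ∫ x, nextDensity R β (firstPoints X k ω) x • (U (firstPoints X k ω) * (g x - a))
        ∂(lebesgue D) ∂P :=
    hX.integral_next h h0 hR k (F := fun p => U p.1 * (g p.2 - a)) (M := s)
      ((hU.comp measurable_fst).mul (hga.comp measurable_snd)).stronglyMeasurable
      (fun p => hUs _ _)
  have e4 : (∫ ω, U (firstPoints X k ω) ∂P) * ∫ x, (g x - a) ∂(limitLaw βlim) =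
      ∫ ω, ∫ x, (βlim x / B) • (U (firstPoints X k ω) * (g x - a)) ∂(lebesgue D) ∂P := by
    rw [integral_limitLaw hlim hlim0, ← integral_mul_const]
    congr with ω
    rw [← integral_const_mul]
    congr with x
    rw [mul_smul_comm]
  have hbase : ∀ ω, Integrable (fun x => nextDensity R β (firstPoints X k ω) x - βlim x / B)
      (lebesgue D) := fun ω => (h.integrable_nextDensity hR _).sub (hlimint.div_const B)
  have hbound : ∀ ω, ‖∫ x, (nextDensity R β (firstPoints X k ω) x - βlim x / B) •
        (U (firstPoints X k ω) * (g x - a)) ∂(lebesgue D)‖ ≤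
      s * ∫ x, |nextDensity R β (firstPoints X k ω) x - βlim x / B| ∂(lebesgue D) := by
    intro ω
    rw [← integral_const_mul]
    refine norm_integral_le_of_norm_le ((hbase ω).abs.const_mul s) (ae_of_all _ fun x => ?_)
    rw [norm_smul, mul_comm, Real.norm_eq_abs]
    exact mul_le_mul_of_nonneg_right (hUs _ _) (abs_nonneg _)
  have hsm : ∀ ω, Integrable (fun x => U (firstPoints X k ω) * (g x - a)) (lebesgue D) := fun ω =>
    (hgint _ inferInstance).const_mul _
  have hsub : ∀ ω, (∫ x, nextDensity R β (firstPoints X k ω) x •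
        (U (firstPoints X k ω) * (g x - a)) ∂(lebesgue D)) -
        ∫ x, (βlim x / B) • (U (firstPoints X k ω) * (g x - a)) ∂(lebesgue D) =
      ∫ x, (nextDensity R β (firstPoints X k ω) x - βlim x / B) •
        (U (firstPoints X k ω) * (g x - a)) ∂(lebesgue D) := by
    intro ω
    simp_rw [sub_smul]
    exact (integral_sub
      ((h.integrable_nextDensity hR _).smul_bdd s (hsm ω).aestronglyMeasurable
        (ae_of_all _ fun x => hUs _ _))
      ((hlimint.div_const B).smul_bdd s (hsm ω).aestronglyMeasurable
        (ae_of_all _ fun x => hUs _ _))).symm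
  have hψi : Integrable (fun p : Ω × D => nextDensity R β (firstPoints X k p.1) p.2)
      (P.prod (lebesgue D)) := by
    have hp : Measurable (fun p : Ω × D => (firstPoints X k p.1, p.2)) :=
      (hm.comp measurable_fst).prodMk measurable_snd
    have hψm := (h.measurable_nextDensity hR k).comp hp
    simp only [Function.comp_def] at hψm
    refine Integrable.of_bound (C := C / ∫ u, βs u ∂(lebesgue D)) hψm.aestronglyMeasurable
      (ae_of_all _ fun p => ?_)
    rw [Real.norm_of_nonneg (h.nextDensity_nonneg h0 hR _ _)]
    exact h.nextDensity_le h0 hR _ _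
  have hI1 : Integrable (fun ω => ∫ x, nextDensity R β (firstPoints X k ω) x •
      (U (firstPoints X k ω) * (g x - a)) ∂(lebesgue D)) P :=
    (hψi.smul_bdd (f := fun p : Ω × D => U (firstPoints X k p.1) * (g p.2 - a)) s
      ((hUm.comp measurable_fst).mul (hga.comp measurable_snd)).aestronglyMeasurable
      (ae_of_all _ fun p => hUs _ _)).integral_prod_left
  have hI2 : Integrable (fun ω => ∫ x, (βlim x / B) • (U (firstPoints X k ω) * (g x - a))
      ∂(lebesgue D)) P :=
    (((hlimint.div_const B).comp_snd P).smul_bdd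
      (f := fun p : Ω × D => U (firstPoints X k p.1) * (g p.2 - a)) s
      ((hUm.comp measurable_fst).mul (hga.comp measurable_snd)).aestronglyMeasurable
      (ae_of_all _ fun p => hUs _ _)).integral_prod_left
  rw [e1, e3, e4, ← integral_sub hI1 hI2, discrepancy, ← integral_const_mul]
  refine norm_integral_le_of_norm_le
    ((hψi.sub ((hlimint.div_const B).comp_snd P)).abs.integral_prod_left.const_mul s)
    (ae_of_all _ fun ω => ?_)
  rw [hsub]
  exact hbound ω

/-- The expected product of `g` over the first `m` points is close to its value for independent
points with the limit law. -/
lemma IsAdsorptionSequence.norm_integral_prod_sub_pow_le (hX : IsAdsorptionSequence P R β X)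
    (h : IntensityBounds β βs C) (h0 : lebesgue D ≠ 0) (hR : Measurable R)
    (hlim : Measurable βlim) (hlim0 : ∀ x, 0 ≤ βlim x)
    (hlimint : Integrable βlim (lebesgue D)) (hlimpos : 0 < ∫ u, βlim u ∂(lebesgue D))
    {g : D → ℂ} (hg : Measurable g) (hg1 : ∀ x, ‖g x‖ ≤ 1) {s : ℝ}
    (hgs : ∀ x, ‖g x - 1‖ ≤ s) (m : ℕ) :
    ‖(∫ ω, ∏ k ∈ Finset.range m, g (X k ω) ∂P) - (∫ x, g x ∂(limitLaw βlim)) ^ m‖ ≤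
      s * ∑ k ∈ Finset.range m, discrepancy P R β βlim X k := by
  have : IsProbabilityMeasure (limitLaw βlim) := isProbabilityMeasure_limitLaw hlim0 hlimint hlimpos
  have hJ : ‖∫ x, g x ∂(limitLaw βlim)‖ ≤ 1 := by
    simpa using norm_integral_le_of_norm_le_const (μ := limitLaw βlim) (ae_of_all _ hg1)
  induction m with
  | zero => simp
  | succ m ih =>
    have hstep := hX.norm_integral_mul_sub_le h h0 hR hlim hlim0 hlimint hlimpos m
      (U := fun y => ∏ i, g (y i)) (Finset.measurable_prod _ fun i _ => hg.comp (measurable_pi_apply i))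
      (fun y => by
        rw [norm_prod]
        exact Finset.prod_le_one (fun i _ => norm_nonneg _) fun i _ => hg1 _) hg hgs
    have hprod : ∀ ω, ∏ i, g (firstPoints X m ω i) = ∏ k ∈ Finset.range m, g (X k ω) := fun ω =>
      (Finset.prod_range fun k => g (X k ω)).symm
    simp_rw [hprod, ← Finset.prod_range_succ (fun k => g (X k _)) m] at hstep
    set q := ∫ x, g x ∂(limitLaw βlim)
    set E := ∫ ω, ∏ k ∈ Finset.range m, g (X k ω) ∂P
    rw [Finset.sum_range_succ, mul_add, pow_succ]
    have e : ∀ z : ℂ, z - q ^ m * q = (E - q ^ m) * q + (z - E * q) := fun z => by ring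
    rw [e]
    refine (norm_add_le _ _).trans (add_le_add ?_ hstep)
    rw [norm_mul]
    exact (mul_le_of_le_one_right (norm_nonneg _) hJ).trans ih

lemma IsAdsorptionSequence.abs_integral_sub_le (hX : IsAdsorptionSequence P R β X)
    (h : IntensityBounds β βs C) (h0 : lebesgue D ≠ 0) (hR : Measurable R)
    (hlim : Measurable βlim) (hlim0 : ∀ x, 0 ≤ βlim x)
    (hlimint : Integrable βlim (lebesgue D)) (hlimpos : 0 < ∫ u, βlim u ∂(lebesgue D))
    {f : D → ℝ} (hf : Measurable f) {s : ℝ} (hfs : ∀ x, |f x| ≤ s) (k : ℕ) :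
    |(∫ ω, f (X k ω) ∂P) - limitMean βlim f| ≤ s * discrepancy P R β βlim X k := by
  have := hX.norm_integral_mul_sub_le h h0 hR hlim hlim0 hlimint hlimpos k (𝕜 := ℝ)
    (U := fun _ => 1) measurable_const (by simp) hf (a := 0) (s := s) (by simpa using hfs)
  simpa [limitMean_eq_integral hlim hlim0] using this

end Discrepancy

/-! ### Isonormal Gaussian processes -/

/-- The isonormal process of a real Hilbert space `H`: a linear isometry of `H` onto a
space of centred Gaussian variables. It sends a Hilbert basis to independent standard Gaussians. -/
theorem exists_isonormal (H : Type*) [NormedAddCommGroup H] [InnerProductSpace ℝ H]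
    [CompleteSpace H] :
    ∃ (w : Set H) (μ : Measure (w → ℝ)) (_ : IsProbabilityMeasure μ) (W : H →ₗᵢ[ℝ] Lp ℝ 2 μ),
      ∀ h, μ.map (W h) = gaussianReal 0 (‖h‖₊ ^ 2) := by
  obtain ⟨w, b, -⟩ := exists_hilbertBasis ℝ H
  classical
  set μ : Measure (w → ℝ) := Measure.infinitePi fun _ => gaussianReal 0 1 with hμ
  have hindep : iIndepFun (fun i (ω : w → ℝ) => ω i) μ :=
    iIndepFun_infinitePi (X := fun _ x => x) fun _ => measurable_id
  have hlaw : ∀ i : w, HasLaw (fun ω : w → ℝ => ω i) (gaussianReal 0 1) μ := fun i =>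
    ⟨(measurable_pi_apply i).aemeasurable, Measure.infinitePi_map_eval _ i⟩
  have hmem : ∀ i : w, MemLp (fun ω : w → ℝ => ω i) 2 μ := fun i =>
    (hlaw i).hasGaussianLaw.memLp_two
  have hmean : ∀ i : w, ∫ ω, ω i ∂μ = 0 := fun i => by
    simpa using (hlaw i).integral_comp (f := id) aestronglyMeasurable_id
  have hvar : ∀ i : w, ∫ ω, ω i * ω i ∂μ = 1 := fun i => by
    have := (hlaw i).variance_eq
    rw [variance_id_gaussianReal, variance_of_integral_eq_zero (hlaw i).aemeasurable (hmean i)] at this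
    simpa [sq] using this
  have hortho : Orthonormal ℝ fun i => (hmem i).toLp := by
    rw [orthonormal_iff_ite]
    intro i j
    have e : inner ℝ (hmem i).toLp (hmem j).toLp = ∫ ω, ω i * ω j ∂μ := by
      rw [L2.inner_def]
      refine integral_congr_ae ?_
      filter_upwards [(hmem i).coeFn_toLp, (hmem j).coeFn_toLp] with ω h1 h2
      rw [h1, h2]
      simp [mul_comm]
    rw [e]
    split_ifs with hij
    · rw [← hij, hvar]
    · rw [(hindep.indepFun hij).integral_fun_mul_eq_mul_integral (hmem i).1 (hmem j).1, hmean]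
      simp
  set W : H →ₗᵢ[ℝ] Lp ℝ 2 μ :=
    hortho.orthogonalFamily.linearIsometry.comp b.repr.toLinearIsometry with hW
  have hWb : ∀ i, W (b i) = (hmem i).toLp := fun i => by
    simp [hW, b.repr_self, hortho.orthogonalFamily.linearIsometry_apply_single]
  -- the characteristic function at `1` of a finite linear combination of basis vectors
  have hfin : ∀ (s : Finset w) (c : w → ℝ),
      charFun (μ.map (W (∑ i ∈ s, c i • b i))) 1 =
        Complex.exp (-(‖∑ i ∈ s, c i • b i‖ : ℂ) ^ 2 / 2) := by
    intro s c
    have e1 : W (∑ i ∈ s, c i • b i) =ᵐ[μ] fun ω => ∑ i ∈ s, c i * ω i := by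
      have e2 : W (∑ i ∈ s, c i • b i) = ∑ i ∈ s, c i • (hmem i).toLp := by simp [hWb]
      rw [e2]
      refine (Lp.coeFn_finsetSum _ _).trans ?_
      have e3 : ∀ᵐ ω ∂μ, ∀ i ∈ s, (c i • (hmem i).toLp : Lp ℝ 2 μ) ω = c i * ω i := by
        refine (ae_ball_iff s.countable_toSet).2 fun i _ => ?_
        filter_upwards [Lp.coeFn_smul (c i) (hmem i).toLp, (hmem i).coeFn_toLp] with ω h1 h2
        rw [h1, Pi.smul_apply, h2, smul_eq_mul]
      filter_upwards [e3] with ω hω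
      rw [Finset.sum_apply]
      exact Finset.sum_congr rfl fun i hi => hω i hi
    have hnorm : ‖∑ i ∈ s, c i • b i‖ ^ 2 = ∑ i ∈ s, c i ^ 2 := by
      rw [← real_inner_self_eq_norm_sq, b.orthonormal.inner_sum]
      simp [sq]
    have hind : iIndepFun (fun i (ω : w → ℝ) => c i * ω i) μ :=
      iIndepFun_infinitePi (X := fun i x => c i * x) fun i => measurable_const_mul (c i)
    rw [Measure.map_congr e1, (hind.precomp (g := ((↑) : s → w))
      Subtype.val_injective).charFun_map_fun_finsetSum_eq_prod
        (fun i _ => ((measurable_pi_apply i).const_mul _).aemeasurable), Finset.prod_apply]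
    have e4 : ∀ i, charFun (μ.map fun ω => c i * ω i) 1 = Complex.exp (-((c i : ℂ) ^ 2) / 2) := by
      intro i
      rw [charFun_map_mul_comp (measurable_pi_apply i).aemeasurable, (hlaw i).map_eq,
        charFun_gaussianReal]
      simp [neg_div]
    simp_rw [e4]
    rw [← Complex.exp_sum, ← Complex.ofReal_pow, hnorm, ← Finset.sum_div, Finset.sum_neg_distrib]
    push_cast
    rfl
  -- both sides are continuous in `h`: convergence in `L²` implies convergence in distribution
  have hseq : Continuous fun h : H => charFun (μ.map (W h)) 1 := by
    refine continuous_iff_seqContinuous.2 fun u h hu => ?_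
    have h1 := tendstoInMeasure_of_tendsto_Lp ((W.continuous.tendsto h).comp hu)
    have h2 := h1.tendstoInDistribution fun i => (Lp.aestronglyMeasurable _).aemeasurable
    exact ProbabilityMeasure.tendsto_iff_tendsto_charFun.1 h2.tendsto 1
  have hone : ∀ h : H, charFun (μ.map (W h)) 1 = Complex.exp (-(‖h‖ : ℂ) ^ 2 / 2) := by
    intro h
    have hs := b.hasSum_repr h
    have hc : Continuous fun h : H => Complex.exp (-(‖h‖ : ℂ) ^ 2 / 2) := by fun_prop
    have l1 := (hseq.tendsto h).comp hs
    have l2 := (hc.tendsto h).comp hs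
    refine tendsto_nhds_unique l1 (l2.congr fun s => ?_)
    exact (hfin s _).symm
  refine ⟨w, μ, inferInstance, W, fun h => Measure.ext_of_charFun ?_⟩
  ext t
  have haem : AEMeasurable (W h) μ := (Lp.aestronglyMeasurable _).aemeasurable
  have e := charFun_map_mul_comp haem t 1
  rw [mul_one] at e
  have e5 : (fun ω => t * W h ω) =ᵐ[μ] W (t • h) := by
    rw [map_smul]
    filter_upwards [Lp.coeFn_smul t (W h)] with ω hω
    rw [hω]; rfl
  -- the argument `t` is absorbed by the linearity of `W`
  rw [← e, Measure.map_congr e5, hone, charFun_gaussianReal, norm_smul]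
  congr 1
  push_cast
  rw [mul_pow, ← Complex.ofReal_pow ‖t‖, Real.norm_eq_abs, sq_abs]
  push_cast
  simp
  ring

/-! ### The central limit theorem for characteristic functions -/

/-- The central limit theorem for independent points with law `ν`, in terms of characteristic
functions. -/
lemma tendsto_integral_cexp_pow {S : Type*} [MeasurableSpace S] (ν : Measure S)
    [IsProbabilityMeasure ν] {f : S → ℝ} (hf : Measurable f) {M : ℝ} (hM : ∀ x, |f x| ≤ M) :
    Tendsto (fun m : ℕ =>
        (∫ x, Complex.exp (Complex.I * ((f x - ∫ y, f y ∂ν) / √(m : ℝ) : ℝ)) ∂ν) ^ m)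
      atTop (𝓝 (Complex.exp (-(Var[f; ν] : ℂ) / 2))) := by
  set a := ∫ y, f y ∂ν with ha
  have hfint : Integrable f ν := Integrable.of_bound (C := M) hf.aestronglyMeasurable (ae_of_all _ hM)
  set μ : Measure (ℕ → S) := Measure.infinitePi fun _ => ν with hμ
  set Y : ℕ → (ℕ → S) → ℝ := fun k ω => f (ω k) - a with hY
  have hYm : ∀ k, Measurable (Y k) := fun k => (hf.comp (measurable_pi_apply k)).sub_const a
  have hindep : iIndepFun Y μ := iIndepFun_infinitePi (X := fun _ x => f x - a) fun _ => hf.sub_const a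
  have hlaw : ∀ k, HasLaw (Y k) (ν.map fun x => f x - a) μ := fun k => by
    refine ⟨(hYm k).aemeasurable, ?_⟩
    rw [← Measure.infinitePi_map_eval (fun _ => ν) k,
      Measure.map_map (hf.sub_const a) (measurable_pi_apply k)]
    rfl
  have hident : ∀ k, IdentDistrib (Y k) (Y 0) μ μ := fun k => (hlaw k).identDistrib (hlaw 0)
  have hid : IdentDistrib (Y 0) (fun x => f x - a) μ ν :=
    ⟨(hYm 0).aemeasurable, (hf.sub_const a).aemeasurable, (hlaw 0).map_eq⟩
  have hmean : μ[Y 0] = 0 := by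
    rw [hid.integral_eq, integral_sub hfint (integrable_const a)]
    simp [ha]
  have hvar : Var[Y 0; μ] = Var[f; ν] := by
    rw [hid.variance_eq, variance_sub_const hf.aestronglyMeasurable]
  have hL2 : MemLp (Y 0) 2 μ := MemLp.of_bound (hYm 0).aestronglyMeasurable (M + |a|)
    (ae_of_all _ fun ω => (abs_sub _ _).trans (by gcongr; exact hM _))
  have hclt := tendstoInDistribution_inv_sqrt_mul_sum_sub (P := μ) (X := Y) (Y := id)
    (P' := gaussianReal 0 Var[Y 0; μ].toNNReal) HasLaw.id hL2 hindep hident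
  have hchar := ProbabilityMeasure.tendsto_iff_tendsto_charFun.1 hclt.tendsto 1
  simp only [ProbabilityMeasure.coe_mk, hmean, mul_zero, sub_zero, Measure.map_id,
    charFun_gaussianReal, hvar, Real.coe_toNNReal _ (variance_nonneg f ν)] at hchar
  have e : ∀ m : ℕ, charFun (μ.map fun ω => (√(m : ℝ))⁻¹ * ∑ k ∈ Finset.range m, Y k ω) 1 =
      (∫ x, Complex.exp (Complex.I * ((f x - a) / √(m : ℝ) : ℝ)) ∂ν) ^ m := by
    intro m
    rw [charFun_inv_sqrt_mul_sum hindep hident, (hlaw 0).map_eq, charFun_apply_real,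
      integral_map (hf.sub_const a).aemeasurable (by fun_prop)]
    congr 2 with x
    push_cast
    congr 1
    ring
  simp_rw [e] at hchar
  convert! hchar using 2
  simp [neg_div]

/-! ### The limiting Gaussian field -/

lemma BddMeas.memLp (f : BddMeas D) (ν : Measure D) [IsFiniteMeasure ν] (p : ENNReal) :
    MemLp (f : D → ℝ) p ν :=
  MemLp.of_bound f.2.1.aestronglyMeasurable f.2.2.choose (ae_of_all _ f.2.2.choose_spec)

/-- The Gaussian field indexed by bounded functions whose covariance is the covariance under a
given probability measure `ν`: the isonormal process of `L²(ν)` at the centred functions. -/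
theorem exists_gaussianField (ν : Measure D) [IsProbabilityMeasure ν] {G : (D → ℝ) → (D → ℝ) → ℝ}
    (hG : ∀ f g : BddMeas D, G f g = cov[f, g; ν]) :
    ∃ (Ω' : Type) (_ : MeasurableSpace Ω') (P' : Measure Ω') (_ : IsProbabilityMeasure P')
      (Z : BddMeas D → Ω' → ℝ), IsCenteredGaussianField P' G Z := by
  classical
  obtain ⟨w, μ, hμ, W, hW⟩ := exists_isonormal (Lp ℝ 2 ν)
  have hmem : ∀ f : BddMeas D, MemLp (fun x => (f : D → ℝ) x - ∫ y, (f : D → ℝ) y ∂ν) 2 ν :=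
    fun f => (BddMeas.memLp f ν 2).sub (memLp_const _)
  set A : BddMeas D → Lp ℝ 2 ν := fun f => (hmem f).toLp with hA
  have hAlin : ∀ (a b : ℝ) (f g : BddMeas D), A (a • f + b • g) = a • A f + b • A g := by
    intro a b f g
    rw [hA, ← MemLp.toLp_const_smul, ← MemLp.toLp_const_smul, ← MemLp.toLp_add]
    refine MemLp.toLp_congr _ _ (ae_of_all _ fun x => ?_)
    have e : ∫ y, ((a • f + b • g : BddMeas D) : D → ℝ) y ∂ν =
        a * ∫ y, (f : D → ℝ) y ∂ν + b * ∫ y, (g : D → ℝ) y ∂ν := by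
      rw [← integral_const_mul, ← integral_const_mul, ← integral_add]
      · rfl
      · exact ((BddMeas.memLp f ν 1).integrable le_rfl).const_mul a
      · exact ((BddMeas.memLp g ν 1).integrable le_rfl).const_mul b
    have hx : ((a • f + b • g : BddMeas D) : D → ℝ) x = a * (f : D → ℝ) x + b * (g : D → ℝ) x := rfl
    beta_reduce
    rw [e, hx]
    simp only [Pi.add_apply, Pi.smul_apply, smul_eq_mul]
    ring
  have hinner : ∀ f g : BddMeas D, inner ℝ (A f) (A g) = cov[f, g; ν] := by
    intro f g
    rw [L2.inner_def, covariance]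
    refine integral_congr_ae ?_
    filter_upwards [(hmem f).coeFn_toLp, (hmem g).coeFn_toLp] with x h1 h2
    rw [hA]
    simp only [h1, h2]
    simp [mul_comm]
  have haem : ∀ h : Lp ℝ 2 ν, AEMeasurable (W h) μ := fun h => (Lp.aestronglyMeasurable _).aemeasurable
  have hlaw : ∀ h : Lp ℝ 2 ν, HasLaw (W h) (gaussianReal 0 (‖h‖₊ ^ 2)) μ := fun h => ⟨haem h, hW h⟩
  have hmean : ∀ h : Lp ℝ 2 ν, ∫ ω, W h ω ∂μ = 0 := fun h => by
    simpa using (hlaw h).integral_comp (f := id) aestronglyMeasurable_id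
  refine ⟨w → ℝ, inferInstance, μ, hμ, fun f => W (A f), ⟨⟨fun I => ⟨?_⟩⟩, ?_, fun f => hmean _, ?_⟩⟩
  · refine isGaussian_of_map_eq_gaussianReal fun L =>
      ⟨0, ‖∑ i : I, L (Pi.single i 1) • A i‖₊ ^ 2, ?_⟩
    have hm : AEMeasurable (fun ω => I.restrict (fun f => W (A f) ω)) μ :=
      aemeasurable_pi_lambda _ fun i => haem _
    rw [AEMeasurable.map_map_of_aemeasurable L.continuous.measurable.aemeasurable hm, ← hW]
    refine Measure.map_congr ?_
    have e1 : W (∑ i : I, L (Pi.single i 1) • A i) = ∑ i : I, L (Pi.single i 1) • W (A i) := by simp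
    rw [e1]
    have e2 : ∀ᵐ ω ∂μ, ∀ i : I, (L (Pi.single i 1) • W (A i) : Lp ℝ 2 μ) ω =
        L (Pi.single i 1) * W (A i) ω := by
      refine ae_all_iff.2 fun i => ?_
      filter_upwards [Lp.coeFn_smul (L (Pi.single i 1)) (W (A i))] with ω hω
      rw [hω]; rfl
    filter_upwards [e2, Lp.coeFn_finsetSum Finset.univ fun i : I => L (Pi.single i 1) • W (A i)]
      with ω h1 h2
    rw [h2, Finset.sum_apply, Function.comp_apply]
    have e3 := LinearMap.pi_apply_eq_sum_univ L.toLinearMap (I.restrict fun f => W (A f) ω)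
    simp only [ContinuousLinearMap.coe_coe] at e3
    rw [e3]
    refine Finset.sum_congr rfl fun i _ => ?_
    rw [h1, smul_eq_mul, mul_comm]
    congr 2
    ext j
    simp [Pi.single_apply, eq_comm]
  · intro a b f g
    rw [hAlin, map_add, map_smul, map_smul]
    filter_upwards [Lp.coeFn_add (a • W (A f)) (b • W (A g)), Lp.coeFn_smul a (W (A f)),
      Lp.coeFn_smul b (W (A g))] with ω h1 h2 h3
    rw [h1, Pi.add_apply, h2, h3]
    rfl
  · intro f g
    rw [hG, ← hinner, ← W.inner_map_map, L2.inner_def, covariance, hmean, hmean]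
    refine integral_congr_ae (ae_of_all _ fun ω => ?_)
    simp only [sub_zero, RCLike.inner_apply, conj_trivial]
    exact mul_comm _ _

lemma IsCenteredGaussianField.map_eq {Ω : Type*} [MeasurableSpace Ω] {P : Measure Ω}
    {G : (D → ℝ) → (D → ℝ) → ℝ} {Z : BddMeas D → Ω → ℝ} (hZ : IsCenteredGaussianField P G Z)
    (f : BddMeas D) : P.map (Z f) = gaussianReal 0 (G f f).toNNReal := by
  have h := hZ.gaussian.hasGaussianLaw_eval f
  rw [h.map_eq_gaussianReal, hZ.mean_zero, ← hZ.cov, covariance_self h.aemeasurable]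

lemma IsCenteredGaussianField.sum_ae_eq {Ω : Type*} [MeasurableSpace Ω] {P : Measure Ω}
    {G : (D → ℝ) → (D → ℝ) → ℝ} {Z : BddMeas D → Ω → ℝ} (hZ : IsCenteredGaussianField P G Z)
    {ι : Type*} (s : Finset ι) (t : ι → ℝ) (f : ι → BddMeas D) :
    Z (∑ i ∈ s, t i • f i) =ᵐ[P] fun ω => ∑ i ∈ s, t i * Z (f i) ω := by
  classical
  induction s using Finset.induction_on with
  | empty => simpa using hZ.linear 0 0 0 0
  | insert i s hi ih =>
    have h1 := hZ.linear (t i) 1 (f i) (∑ i ∈ s, t i • f i)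
    rw [one_smul] at h1
    rw [Finset.sum_insert hi]
    filter_upwards [h1, ih] with ω h2 h3
    rw [h2, h3, Finset.sum_insert hi, one_mul]

/-! ### Fluctuations -/

section Fluctuation

variable {Ω : Type*} [MeasurableSpace Ω] {P : Measure Ω} [IsProbabilityMeasure P] {X : ℕ → Ω → D}

lemma integrable_comp_point (hX : ∀ k, Measurable (X k)) (f : BddMeas D) (k : ℕ) :
    Integrable (fun ω => (f : D → ℝ) (X k ω)) P :=
  Integrable.of_bound (f.2.1.comp (hX k)).aestronglyMeasurable f.2.2.choose
    (ae_of_all _ fun _ => f.2.2.choose_spec _)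

lemma fluctuation_eq (hX : ∀ k, Measurable (X k)) (f : BddMeas D) (m : ℕ) (ω : Ω) :
    fluctuation P X m f ω = (1 / √(m : ℝ)) *
      ∑ k ∈ Finset.range m, ((f : D → ℝ) (X k ω) - ∫ ω', (f : D → ℝ) (X k ω') ∂P) := by
  have h1 : ∀ ω, ∫ x, (f : D → ℝ) x ∂(pointMeasure X m ω) =
      ∑ k ∈ Finset.range m, (f : D → ℝ) (X k ω) := by
    intro ω
    rw [pointMeasure, integral_finsetSum_measure
      fun k _ => (BddMeas.memLp f (Measure.dirac (X k ω)) 1).integrable le_rfl]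
    simp
  rw [fluctuation]
  simp_rw [h1]
  rw [integral_finsetSum _ fun k _ => integrable_comp_point hX f k, Finset.sum_sub_distrib]
  ring

lemma measurable_fluctuation (hX : ∀ k, Measurable (X k)) (f : BddMeas D) (m : ℕ) :
    Measurable (fluctuation P X m f) := by
  have : fluctuation P X m f = fun ω => (1 / √(m : ℝ)) *
      ∑ k ∈ Finset.range m, ((f : D → ℝ) (X k ω) - ∫ ω', (f : D → ℝ) (X k ω') ∂P) :=
    funext fun ω => fluctuation_eq hX f m ω
  rw [this]
  exact (Finset.measurable_sum _ fun k _ => (f.2.1.comp (hX k)).sub_const _).const_mul _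

lemma fluctuation_sum (hX : ∀ k, Measurable (X k)) {ι : Type*} (s : Finset ι) (t : ι → ℝ)
    (f : ι → BddMeas D) (m : ℕ) (ω : Ω) :
    fluctuation P X m ((∑ i ∈ s, t i • f i : BddMeas D) : D → ℝ) ω =
      ∑ i ∈ s, t i * fluctuation P X m (f i) ω := by
  simp_rw [fluctuation_eq hX]
  have e : ∀ x, ((∑ i ∈ s, t i • f i : BddMeas D) : D → ℝ) x = ∑ i ∈ s, t i * (f i : D → ℝ) x := by
    intro x
    simp [Finset.sum_apply]
  simp_rw [e, integral_finsetSum s fun i _ => (integrable_comp_point (P := P) hX (f i) _).const_mul (t i),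
    integral_const_mul, ← Finset.sum_sub_distrib, ← mul_sub]
  rw [Finset.sum_comm, Finset.mul_sum]
  refine Finset.sum_congr rfl fun i _ => ?_
  rw [← Finset.mul_sum]
  ring

/-- The comparison with independent points turns the central limit theorem for the limit law into
convergence of the characteristic functions of the fluctuations. -/
lemma IsAdsorptionSequence.tendsto_integral_cexp_fluctuation [IsFiniteMeasure (lebesgue D)]
    {β : ℕ → D → ℝ} {βs : D → ℝ} {C : ℝ} {R : D → ℝ} {βlim : D → ℝ}
    (hX : IsAdsorptionSequence P R β X)
    (h : IntensityBounds β βs C) (h0 : lebesgue D ≠ 0) (hR : Measurable R)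
    (hlim : Measurable βlim) (hlim0 : ∀ x, 0 ≤ βlim x)
    (hlimint : Integrable βlim (lebesgue D)) (hlimpos : 0 < ∫ u, βlim u ∂(lebesgue D))
    (hdisc : Tendsto (fun m : ℕ => (1 / √(m : ℝ)) *
      ∑ k ∈ Finset.range m, discrepancy P R β βlim X k) atTop (𝓝 0)) (f : BddMeas D) :
    Tendsto (fun m : ℕ => ∫ ω, Complex.exp (Complex.I * (fluctuation P X m f ω : ℝ)) ∂P) atTop
      (𝓝 (Complex.exp (-(Var[(f : D → ℝ); limitLaw βlim] : ℂ) / 2))) := by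
  have : IsProbabilityMeasure (limitLaw βlim) := isProbabilityMeasure_limitLaw hlim0 hlimint hlimpos
  obtain ⟨hf, M, hM⟩ := f.2
  set J := limitMean βlim f with hJ
  have hJint : ∫ y, (f : D → ℝ) y ∂(limitLaw βlim) = J := (limitMean_eq_integral hlim hlim0 _).symm
  have hiid := tendsto_integral_cexp_pow (limitLaw βlim) hf hM
  rw [hJint] at hiid
  set S : ℕ → ℝ := fun m => ∑ k ∈ Finset.range m, discrepancy P R β βlim X k with hS
  set g : ℕ → D → ℂ := fun m x => Complex.exp (Complex.I * (((f : D → ℝ) x - J) / √(m : ℝ) : ℝ))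
    with hg
  have hgm : ∀ m, Measurable (g m) := fun m =>
    Complex.measurable_exp.comp ((Complex.measurable_ofReal.comp
      ((hf.sub_const J).div_const _)).const_mul Complex.I)
  have hcmp : Tendsto (fun m : ℕ => (∫ ω, ∏ k ∈ Finset.range m, g m (X k ω) ∂P) -
      (∫ x, g m x ∂(limitLaw βlim)) ^ m) atTop (𝓝 0) := by
    have hz : Tendsto (fun m : ℕ => (M + |J|) * ((1 / √(m : ℝ)) * S m)) atTop (𝓝 0) := by
      simpa using hdisc.const_mul (M + |J|)
    refine squeeze_zero_norm (fun m => ?_) hz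
    refine (hX.norm_integral_prod_sub_pow_le h h0 hR hlim hlim0 hlimint hlimpos (hgm m)
      (fun x => (Complex.norm_exp_I_mul_ofReal _).le) (s := (M + |J|) / √(m : ℝ)) (fun x => ?_)
      m).trans_eq (by ring)
    refine Real.norm_exp_I_mul_ofReal_sub_one_le.trans ?_
    rw [Real.norm_eq_abs, abs_div, abs_of_nonneg (Real.sqrt_nonneg _)]
    exact div_le_div_of_nonneg_right ((abs_sub _ _).trans (add_le_add (hM x) le_rfl))
      (Real.sqrt_nonneg _)
  -- the fluctuations are centred at the means of `f (X k)`, the comparison at `J`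
  set δ : ℕ → ℝ := fun m => (1 / √(m : ℝ)) *
    ∑ k ∈ Finset.range m, ((∫ ω, (f : D → ℝ) (X k ω) ∂P) - J) with hδ
  have hδ0 : Tendsto δ atTop (𝓝 0) := by
    have hz : Tendsto (fun m : ℕ => M * ((1 / √(m : ℝ)) * S m)) atTop (𝓝 0) := by
      simpa using hdisc.const_mul M
    refine squeeze_zero_norm (fun m => ?_) hz
    rw [hδ, norm_mul, Real.norm_of_nonneg (by positivity), mul_left_comm, hS, Finset.mul_sum]
    refine mul_le_mul_of_nonneg_left ((norm_sum_le _ _).trans (Finset.sum_le_sum fun k _ => ?_))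
      (by positivity)
    exact hX.abs_integral_sub_le h h0 hR hlim hlim0 hlimint hlimpos hf hM k
  have hexpδ : Tendsto (fun m => Complex.exp (-(Complex.I * (δ m : ℂ)))) atTop (𝓝 1) := by
    have hc : Continuous fun x : ℝ => Complex.exp (-(Complex.I * (x : ℂ))) := by fun_prop
    simpa [Function.comp_def] using (hc.tendsto 0).comp hδ0
  have hprod : Tendsto (fun m : ℕ => ∫ ω, ∏ k ∈ Finset.range m, g m (X k ω) ∂P) atTop
      (𝓝 (Complex.exp (-(Var[(f : D → ℝ); limitLaw βlim] : ℂ) / 2))) := by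
    have hadd := hcmp.add hiid
    rw [zero_add] at hadd
    exact hadd.congr fun m => sub_add_cancel _ _
  have hmul := hprod.mul hexpδ
  rw [mul_one] at hmul
  refine hmul.congr fun m => ?_
  rw [← integral_mul_const]
  congr with ω
  rw [hg, ← Complex.exp_sum, ← Complex.exp_add, fluctuation_eq hX.measurable]
  congr 1
  rw [← Finset.mul_sum, ← Complex.ofReal_sum, ← sub_eq_add_neg, ← mul_sub, ← Complex.ofReal_sub]
  congr 2
  rw [← Finset.sum_div, hδ]
  simp only [Finset.sum_sub_distrib]
  ring

end Fluctuation

end CSA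

theorem theorem3 {d : ℕ} {D : Set (EuclideanSpace ℝ (Fin d))}
    (hD : IsCompact D) (hDpos : 0 < volume D)
    {Ω : Type*} [MeasurableSpace Ω] {P : Measure Ω} [IsProbabilityMeasure P]
    -- the interaction radius
    (R : D → ℝ) (hRmeas : Measurable R) (hRinf : ∃ r : ℝ, 0 < r ∧ ∀ x, r ≤ R x)
    -- the intensities and their limit
    (β : ℕ → D → ℝ) (hβmeas : ∀ n, Measurable (β n)) (hβpos : ∀ n x, 0 < β n x)
    (hβbdd : ∃ C : ℝ, ∀ n x, β n x ≤ C)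
    (βlim : D → ℝ) (hβlim : βlim ∈ CSA.BddMeas D)
    (hβlim_inf : ∃ b : ℝ, 0 < b ∧ ∀ x, b ≤ βlim x)
    (hβconv : TendstoUniformly β βlim atTop)
    -- the rate of convergence
    (τ : D → ℝ) (hτ : τ ∈ CSA.BddMeas D) (hτinf : ∃ t : ℝ, 0 < t ∧ ∀ x, t ≤ τ x)
    (φ : ℝ → ℝ) (hφpos : ∀ s, 0 ≤ s → 0 < φ s) (hφlim : Tendsto φ atTop (𝓝 0))
    (hφsum : ∀ δ : ℝ, 0 < δ →
      Tendsto (fun n : ℕ => (1 / √(n : ℝ)) * ∑ k ∈ Finset.range (n + 1), φ ((k : ℝ) * δ))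
        atTop (𝓝 0))
    (hrate : ∀ n x, |β n x - βlim x| ≤ τ x * φ (n : ℝ))
    -- the random points
    (X : ℕ → Ω → D) (hX : CSA.IsAdsorptionSequence P R β X) :
    -- the rescaled measures converge to a generalized Gaussian field, jointly in the test functions
    (∃ (Ω' : Type) (_ : MeasurableSpace Ω') (P' : Measure Ω') (_ : IsProbabilityMeasure P')
      (Z : CSA.BddMeas D → Ω' → ℝ),
      CSA.IsCenteredGaussianField P' (CSA.covKernel βlim) Z ∧
      ∀ (n : ℕ) (f : Fin n → CSA.BddMeas D),
        TendstoInDistribution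
          (fun (m : ℕ) (ω : Ω) (i : Fin n) => CSA.fluctuation P X m (f i) ω) atTop
          (fun (ω' : Ω') (i : Fin n) => Z (f i) ω') (fun _ => P) P') ∧
    -- in particular, for every single test function the normalized sums are asymptotically normal
    (∀ f ∈ CSA.BddMeas D, 0 ≤ CSA.covKernel βlim f f ∧
      TendstoInDistribution
        (fun (m : ℕ) (ω : Ω) =>
          (1 / √(m : ℝ)) * ∑ k ∈ Finset.range m, (f (X k ω) - ∫ ω', f (X k ω') ∂P)) atTop
        (fun y : ℝ => y) (fun _ => P) (gaussianReal 0 (CSA.covKernel βlim f f).toNNReal)) := by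
  obtain ⟨r, hr, hRr⟩ := hRinf
  obtain ⟨C, hC⟩ := hβbdd
  obtain ⟨b, hb, hbβ⟩ := hβlim_inf
  obtain ⟨-, T, hT⟩ := hτ
  have : IsFiniteMeasure (CSA.lebesgue D) := CSA.isFiniteMeasure_lebesgue hD
  have h0 := CSA.lebesgue_ne_zero hD hDpos
  have h := CSA.exists_intensityBounds hβmeas hβpos hC hb hbβ hβconv
  have hlim := hβlim.1
  have hlim0 : ∀ x, 0 ≤ βlim x := fun x => hb.le.trans (hbβ x)
  have hlimint : Integrable βlim (CSA.lebesgue D) :=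
    (CSA.BddMeas.memLp ⟨βlim, hβlim⟩ (CSA.lebesgue D) 1).integrable le_rfl
  have hlimpos : 0 < ∫ u, βlim u ∂(CSA.lebesgue D) := by
    rw [integral_pos_iff_support_of_nonneg hlim0 hlimint]
    have : Function.support βlim = Set.univ := by
      ext x; simp [(hb.trans_le (hbβ x)).ne']
    simpa [this, pos_iff_ne_zero] using h0
  have := CSA.isProbabilityMeasure_limitLaw hlim0 hlimint hlimpos
  have hφ0 : ∀ n : ℕ, 0 ≤ φ n := fun n => (hφpos n n.cast_nonneg).le
  obtain ⟨K, hK⟩ := hX.exists_sum_discrepancy_le hD h h0 hRmeas hr hRr hlim0 hlimint hlimpos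
    (φ := fun n => φ n) hφ0 (T := |T|) (abs_nonneg T) fun n x => (hrate n x).trans
      (mul_le_mul_of_nonneg_right ((le_abs_self _).trans ((hT x).trans (le_abs_self T))) (hφ0 n))
  have hdisc : Tendsto (fun m : ℕ => (1 / √(m : ℝ)) *
      ∑ k ∈ Finset.range m, CSA.discrepancy P R β βlim X k) atTop (𝓝 0) := by
    have hz := (hφsum 1 one_pos).const_mul |K|
    rw [mul_zero] at hz
    refine squeeze_zero (fun m => ?_) (fun m => ?_) hz
    · exact mul_nonneg (by positivity) (Finset.sum_nonneg fun k _ =>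
        integral_nonneg fun ω => integral_nonneg fun x => abs_nonneg _)
    · rw [mul_left_comm]
      refine mul_le_mul_of_nonneg_left ((hK m).trans ?_) (by positivity)
      simp only [mul_one]
      refine mul_le_mul (le_abs_self K) ?_ (Finset.sum_nonneg fun j _ => hφ0 j) (abs_nonneg K)
      exact Finset.sum_le_sum_of_subset_of_nonneg (Finset.range_mono (Nat.le_succ m))
        fun j _ _ => hφ0 j
  have hG : ∀ f g : CSA.BddMeas D,
      CSA.covKernel βlim f g = cov[(f : D → ℝ), g; CSA.limitLaw βlim] := by
    intro f g
    rw [covariance_eq_sub (CSA.BddMeas.memLp f _ 2) (CSA.BddMeas.memLp g _ 2), CSA.covKernel]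
    simp_rw [CSA.limitMean_eq_integral hlim hlim0]
    rfl
  have hGvar : ∀ f : CSA.BddMeas D,
      CSA.covKernel βlim f f = Var[(f : D → ℝ); CSA.limitLaw βlim] := fun f => by
    rw [hG, covariance_self f.2.1.aemeasurable]
  have hchar : ∀ f : CSA.BddMeas D, Tendsto
      (fun m : ℕ => ∫ ω, Complex.exp (Complex.I * (CSA.fluctuation P X m f ω : ℝ)) ∂P) atTop
      (𝓝 (Complex.exp (-(CSA.covKernel βlim f f : ℂ) / 2))) := fun f => by
    rw [hGvar]
    exact hX.tendsto_integral_cexp_fluctuation h h0 hRmeas hlim hlim0 hlimint hlimpos hdisc f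
  have hG0 : ∀ f : CSA.BddMeas D, 0 ≤ CSA.covKernel βlim f f := fun f => by
    rw [hGvar]; exact variance_nonneg _ _
  refine ⟨?_, fun f hf => ⟨hG0 ⟨f, hf⟩, ?_⟩⟩
  · obtain ⟨Ω', mΩ', P', hP', Z, hZ⟩ := CSA.exists_gaussianField (CSA.limitLaw βlim) hG
    refine ⟨Ω', mΩ', P', hP', Z, hZ, fun n f => ?_⟩
    have hZm : ∀ f, AEMeasurable (Z f) P' := fun f => (hZ.gaussian.hasGaussianLaw_eval f).aemeasurable
    have hlp : Measurable (WithLp.toLp 2 : (Fin n → ℝ) → EuclideanSpace ℝ (Fin n)) :=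
      WithLp.measurable_toLp _ _
    have hVm : ∀ m : ℕ, AEMeasurable (fun ω => (WithLp.toLp 2 fun i => CSA.fluctuation P X m (f i) ω :
        EuclideanSpace ℝ (Fin n))) P := fun m => (hlp.comp (measurable_pi_lambda _ fun i =>
          CSA.measurable_fluctuation hX.measurable (f i) m)).aemeasurable
    have hVZ : AEMeasurable (fun ω => (WithLp.toLp 2 fun i => Z (f i) ω :
        EuclideanSpace ℝ (Fin n))) P' :=
      hlp.comp_aemeasurable (aemeasurable_pi_lambda _ fun i => hZm _)
    have hV : TendstoInDistribution (fun (m : ℕ) (ω : Ω) =>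
        (WithLp.toLp 2 fun i => CSA.fluctuation P X m (f i) ω : EuclideanSpace ℝ (Fin n))) atTop
        (fun ω => (WithLp.toLp 2 fun i => Z (f i) ω : EuclideanSpace ℝ (Fin n)))
        (fun _ => P) P' := by
      refine ⟨hVm, hVZ, ProbabilityMeasure.tendsto_iff_tendsto_charFun.2 fun t => ?_⟩
      set F : CSA.BddMeas D := ∑ i, t i • f i with hF
      -- testing against `t` amounts to the single test function `F`
      have e1 : ∀ v : Fin n → ℝ, inner ℝ (WithLp.toLp 2 v : EuclideanSpace ℝ (Fin n)) t =
          ∑ i, t i * v i := fun v => by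
        simp [PiLp.inner_apply]
      have e2 : charFun (P'.map fun ω => (WithLp.toLp 2 fun i => Z (f i) ω :
          EuclideanSpace ℝ (Fin n))) t = Complex.exp (-(CSA.covKernel βlim F F : ℂ) / 2) := by
        have e3 : charFun (P'.map (Z F)) 1 = Complex.exp (-(CSA.covKernel βlim F F : ℂ) / 2) := by
          rw [hZ.map_eq, charFun_gaussianReal, Real.coe_toNNReal _ (hG0 F)]
          simp [neg_div]
        rw [charFun_apply_real, integral_map (hZm F) (by fun_prop)] at e3
        rw [charFun_apply, integral_map hVZ (by fun_prop)]
        simp_rw [e1]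
        rw [← e3]
        refine integral_congr_ae ?_
        filter_upwards [hZ.sum_ae_eq Finset.univ t f] with ω hω
        rw [← hω]
        simp [hF]
      simp only [ProbabilityMeasure.coe_mk]
      rw [e2]
      refine (hchar F).congr fun m => ?_
      rw [charFun_apply, integral_map (hVm m) (by fun_prop)]
      simp_rw [e1, hF, ← CSA.fluctuation_sum hX.measurable Finset.univ t f m, mul_comm Complex.I]
    exact hV.continuous_comp (g := WithLp.ofLp) (PiLp.continuous_ofLp 2 _)
  · have hm : (fun (m : ℕ) (ω : Ω) => (1 / √(m : ℝ)) * ∑ k ∈ Finset.range m,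
        (f (X k ω) - ∫ ω', f (X k ω') ∂P)) = fun m => CSA.fluctuation P X m f :=
      funext fun m => funext fun ω => (CSA.fluctuation_eq hX.measurable ⟨f, hf⟩ m ω).symm
    rw [hm]
    have hfm : ∀ m, AEMeasurable (CSA.fluctuation P X m f) P := fun m =>
      (CSA.measurable_fluctuation hX.measurable ⟨f, hf⟩ m).aemeasurable
    refine ⟨hfm, aemeasurable_id, ProbabilityMeasure.tendsto_iff_tendsto_charFun.2 fun t => ?_⟩
    simp only [ProbabilityMeasure.coe_mk]
    -- the argument `t` is absorbed into the test function
    set F : CSA.BddMeas D := t • ⟨f, hf⟩ with hF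
    have e1 : CSA.covKernel βlim F F = t ^ 2 * CSA.covKernel βlim f f := by
      have e2 := hG ⟨f, hf⟩ ⟨f, hf⟩
      rw [hG, e2, hF, Submodule.coe_smul, covariance_smul_left, covariance_smul_right]
      ring
    have e3 : ∀ m ω, CSA.fluctuation P X m F ω = t * CSA.fluctuation P X m f ω := fun m ω => by
      simpa [hF] using CSA.fluctuation_sum hX.measurable {()} (fun _ => t) (fun _ => ⟨f, hf⟩) m ω
    rw [Measure.map_id', charFun_gaussianReal, Real.coe_toNNReal _ (hG0 ⟨f, hf⟩)]
    have e4 := hchar F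
    rw [e1] at e4
    have e5 : Complex.exp (t * (0 : ℝ) * Complex.I - CSA.covKernel βlim f f * t ^ 2 / 2) =
        Complex.exp (-(t ^ 2 * CSA.covKernel βlim f f : ℝ) / 2) := by
      congr 1; push_cast; ring
    rw [e5]
    refine e4.congr fun m => ?_
    rw [charFun_apply_real, integral_map (hfm m) (by fun_prop)]
    simp_rw [e3, Complex.ofReal_mul, mul_comm Complex.I]
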